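/- There exists a universal constant $h>0$ such that the following holds. Let $\eta>0$, let $c\ge 1$, $n\ge 2$ and $b$ be natural numbers with $b\ge c\cdot\log_2 n$, let $\Lambda=\{0,1\}^b$, and let $g:\Lambda\times\Lambda\to\{0,1\}$ be a function whose discrepancy satisfies $$\mathrm{disc}(g)=\max_{R=A\times B\subseteq\Lambda\times\Lambda}\Big|\Pr[g(U,V)=0,\ (U,V)\in R]-\Pr[g(U,V)=1,\ (U,V)\in R]\Big|\le 2^{-\eta b},$$ where $U,V$ are independent and uniformly distributed over $\Lambda$. Let $0<\gamma,\varepsilon\le 1$ and $\tau>0$ be such that $$\tau\ \ge\ 2+\frac{h}{c\cdot\varepsilon}-\eta+\gamma\qquad\text{and}\qquad \varepsilon\ge\frac4b ,$$ let $\rho\in\{0,1,*\}^n$, and let $X,Y$ be random variables with values in $\Lambda^n$ that are $(\rho,\tau)$-structured. Then the probability that $X_{\mathrm{free}(\rho)}$ takes a value that is $\varepsilon$-dangerous for $Y_{\mathrm{free}(\rho)}$ is at most $2^{-\gamma b}$. Here the following definitions are used. * $\mathrm{free}(\rho)=\{i:\rho_i=*\}$, $\mathrm{fix}(\rho)$ is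 its complement, $x_I$ is the projection of $x$ to the coordinates in $I$, and $g^I(x_I,y_I)=(g(x_i,y_i))_{i\in I}\in\{0,1\}^I$. * The min-entropy $H_\infty(W)$ is the largest real $k$ such that $\Pr[W=w]\le 2^{-k}$ for every value $w$. For a real $\delta$, a random variable $W$ with values in $\Lambda^F$ ($F$ a finite set) is $\delta$-dense if $H_\infty(W_I)\ge\delta\cdot b\cdot|I|$ for every $I\subseteq F$. * $X,Y$ are $(\rho,\tau)$-structured if they are independent, there exist $\delta_X,\delta_Y>0$ with $\delta_X+\delta_Y\ge\tau$ such that $X_{\mathrm{free}(\rho)}$ is $\delta_X$-dense and $Y_{\mathrm{free}(\rho)}$ is $\delta_Y$-dense, and $g^{\mathrm{fix}(\rho)}(X_{\mathrm{fix}(\rho)},Y_{\mathrm{fix}(\rho)})=\rho_{\mathrm{fix}(\rho)}$ with probability $1$. * Let $W$ be a random variable with values in $\Lambda^F$. A value $x\in\Lambda^F$ is leaking for $W$ if there are $I\subseteq F$ and $z_I\in\{0,1\}^I$ with $\Pr[g^I(x_I,W_I)=z_I]<2^{-|I|-1}$. If $W$ is $\delta_Y$-dense with $\delta_Y>0$,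 then $x$ is $\varepsilon$-sparsifying for $W$ (relative to $\delta_Y$) if there are $I\subseteq F$ and $z_I\in\{0,1\}^I$ such that $W_{F\setminus I}$ conditioned on the event $g^I(x_I,W_I)=z_I$ is not $(\delta_Y-\varepsilon)$-dense. Finally, $x$ is $\varepsilon$-dangerous if it is leaking or $\varepsilon$-sparsifying. The conclusion holds for every $\delta_Y>0$ for which $Y_{\mathrm{free}(\rho)}$ is $\delta_Y$-dense. -/

import Mathlib

open MeasureTheory ProbabilityTheory

noncomputable section

namespace Lifting

/-! ### Discrepancy -/

/-- The discrepancy of `g` with respect to the rectangle `A × B`: for independent uniform `U, V`,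
`|Pr[g(U,V) = 0 and (U,V) ∈ A × B] - Pr[g(U,V) = 1 and (U,V) ∈ A × B]|`,
the probabilities being written as counts divided by `|Λ|²`. -/
def rectDisc {Λ : Type*} [Fintype Λ] (g : Λ → Λ → Bool) (A B : Finset Λ) : ℝ :=
  |(((A ×ˢ B).filter (fun p => g p.1 p.2 = false)).card : ℝ) / (Fintype.card Λ : ℝ) ^ 2
    - (((A ×ˢ B).filter (fun p => g p.1 p.2 = true)).card : ℝ) / (Fintype.card Λ : ℝ) ^ 2|

/-- The discrepancy of `g`: the maximum of `rectDisc g A B` over all (finitely many)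
combinatorial rectangles `A × B`. -/
def disc {Λ : Type*} [Fintype Λ] (g : Λ → Λ → Bool) : ℝ :=
  ⨆ R : Finset Λ × Finset Λ, rectDisc g R.1 R.2

/-- The supremum in the definition of `disc` is over a finite family, hence a maximum. -/
theorem isGreatest_disc {Λ : Type*} [Fintype Λ] (g : Λ → Λ → Bool) :
    IsGreatest (Set.range fun R : Finset Λ × Finset Λ => rectDisc g R.1 R.2) (disc g) :=
  ⟨(Set.range_nonempty _).csSup_mem (Set.finite_range _),
    fun _ h => le_csSup (Set.finite_range _).bddAbove h⟩

/-! ### Blocks and the functions `g ^ I` -/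

/-- The alphabet `Λ = {0,1}^b`. -/
abbrev Block (b : ℕ) : Type := Fin b → Bool

/-- The function `g^I : Λ^I × Λ^I → {0,1}^I`, for an arbitrary index set. -/
def gPow {Λ κ : Type*} (g : Λ → Λ → Bool) (x y : κ → Λ) : κ → Bool :=
  fun i => g (x i) (y i)

/-! ### Min-entropy and density -/

/-- The min-entropy of `X` under `P`: the largest real `k` such that `Pr[X = x] ≤ 2^(-k)`
for every value `x`. -/
def minEntropy {Ω α : Type*} [MeasurableSpace Ω] (P : Measure Ω) (X : Ω → α) : ℝ :=
  sSup {k : ℝ | ∀ x : α, P.real (X ⁻¹' {x}) ≤ (2 : ℝ) ^ (-k)}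

/-- For a random variable with finitely many values the largest such `k` exists. -/
theorem isGreatest_minEntropy {Ω α : Type*} [MeasurableSpace Ω] (P : Measure Ω)
    [IsProbabilityMeasure P] [Finite α] (X : Ω → α) :
    IsGreatest {k : ℝ | ∀ x : α, P.real (X ⁻¹' {x}) ≤ (2 : ℝ) ^ (-k)} (minEntropy P X) := by
  have hpos : ∃ x : α, 0 < P.real (X ⁻¹' {x}) := by
    by_contra! h
    have h0 : ∀ x : α, P (X ⁻¹' {x}) = 0 := by
      intro x
      have h1 : P.real (X ⁻¹' {x}) = 0 := le_antisymm (h x) measureReal_nonneg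
      exact (measureReal_eq_zero_iff (measure_ne_top P _)).1 h1
    have h2 : P (⋃ x : α, X ⁻¹' {x}) = 0 := measure_iUnion_null h0
    have h3 : (⋃ x : α, X ⁻¹' {x}) = Set.univ := by
      ext ω
      simp
    rw [h3, measure_univ] at h2
    exact one_ne_zero h2
  have hbdd : BddAbove {k : ℝ | ∀ x : α, P.real (X ⁻¹' {x}) ≤ (2 : ℝ) ^ (-k)} := by
    obtain ⟨x, hx⟩ := hpos
    refine ⟨-Real.logb 2 (P.real (X ⁻¹' {x})), fun k hk => ?_⟩
    have h1 := Real.logb_le_logb_of_le (b := 2) (by norm_num) hx (hk x)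
    rw [Real.logb_rpow (by norm_num) (by norm_num)] at h1
    linarith
  have hne : {k : ℝ | ∀ x : α, P.real (X ⁻¹' {x}) ≤ (2 : ℝ) ^ (-k)}.Nonempty :=
    ⟨0, fun x => by simp [measureReal_le_one]⟩
  have hcl : IsClosed {k : ℝ | ∀ x : α, P.real (X ⁻¹' {x}) ≤ (2 : ℝ) ^ (-k)} := by
    rw [Set.ofPred_forall]
    refine isClosed_iInter fun x => isClosed_le continuous_const ?_
    exact Real.continuous_const_rpow (by norm_num : (2 : ℝ) ≠ 0) |>.comp continuous_neg
  exact ⟨hcl.csSup_mem hne hbdd, fun k hk => le_csSup hbdd hk⟩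

/-- `W`, a random variable with values in `Λ^ι` for `Λ = {0,1}^b`, is `δ`-dense under `P`:
`H_∞(W_I) ≥ δ·b·|I|` for every set `I` of coordinates. -/
def IsDense {Ω ι : Type*} [MeasurableSpace Ω] {b : ℕ} (P : Measure Ω) (δ : ℝ)
    (W : Ω → ι → Block b) : Prop :=
  ∀ I : Finset ι, δ * (b : ℝ) * (I.card : ℝ) ≤ minEntropy P (fun ω => I.restrict (W ω))

/-! ### Restrictions and structured variables -/

/-- The free coordinates of a restriction `ρ ∈ {0,1,*}^n`, with `*` represented by `none`. -/
def free {n : ℕ} (ρ : Fin n → Option Bool) : Finset (Fin n) :=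
  Finset.univ.filter (fun i => ρ i = none)

/-- `X` and `Y` are independent and `(ρ, τ)`-structured (with respect to the gadget `g`).
The last conjunct is `g^{fix(ρ)}(X_{fix(ρ)}, Y_{fix(ρ)}) = ρ_{fix(ρ)}`, with probability one. -/
def IsStructured {Ω : Type*} [MeasurableSpace Ω] {b n : ℕ} (P : Measure Ω)
    (g : Block b → Block b → Bool) (ρ : Fin n → Option Bool) (τ : ℝ)
    (X Y : Ω → Fin n → Block b) : Prop :=
  IndepFun X Y P ∧
  (∃ δX δY : ℝ, 0 < δX ∧ 0 < δY ∧
    IsDense P δX (fun ω => (free ρ).restrict (X ω)) ∧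
    IsDense P δY (fun ω => (free ρ).restrict (Y ω)) ∧
    τ ≤ δX + δY) ∧
  ∀ᵐ ω ∂P, ∀ i : Fin n, i ∉ free ρ → ρ i = some (g (X ω i) (Y ω i))

/-! ### Dangerous values -/

/-- The event `g^I(x_I, W_I) = z_I`. -/
def gadgetEvent {Ω ι : Type*} {b : ℕ} (g : Block b → Block b → Bool) (W : Ω → ι → Block b)
    (x : ι → Block b) (I : Finset ι) (z : I → Bool) : Set Ω :=
  {ω | gPow g (I.restrict x) (I.restrict (W ω)) = z}

/-- `x` is leaking for `W`: `Pr[g^I(x_I, W_I) = z_I] < 2^(-|I|-1)` for some `I` and `z_I`. -/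
def IsLeaking {Ω ι : Type*} [MeasurableSpace Ω] {b : ℕ} (P : Measure Ω)
    (g : Block b → Block b → Bool) (W : Ω → ι → Block b) (x : ι → Block b) : Prop :=
  ∃ (I : Finset ι) (z : I → Bool),
    P.real (gadgetEvent g W x I z) < (2 : ℝ) ^ (-(I.card : ℝ) - 1)

/-- `x` is `ε`-sparsifying for the `δ`-dense variable `W`: for some `I` and `z_I`, the variable
`W` restricted to the coordinates outside `I` and conditioned on `g^I(x_I, W_I) = z_I` is not
`(δ - ε)`-dense. -/
def IsSparsifying {Ω ι : Type*} [MeasurableSpace Ω] [Fintype ι] [DecidableEq ι] {b : ℕ}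
    (P : Measure Ω) (g : Block b → Block b → Bool) (δ ε : ℝ) (W : Ω → ι → Block b)
    (x : ι → Block b) : Prop :=
  ∃ (I : Finset ι) (z : I → Bool),
    ¬ IsDense (ProbabilityTheory.cond P (gadgetEvent g W x I z)) (δ - ε)
        (fun ω => (Iᶜ : Finset ι).restrict (W ω))

/-- `x` is `ε`-dangerous for the `δ`-dense variable `W`. -/
def IsDangerous {Ω ι : Type*} [MeasurableSpace Ω] [Fintype ι] [DecidableEq ι] {b : ℕ}
    (P : Measure Ω) (g : Block b → Block b → Bool) (δ ε : ℝ) (W : Ω → ι → Block b)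
    (x : ι → Block b) : Prop :=
  IsLeaking P g W x ∨ IsSparsifying P g δ ε W x

end Lifting

end

/-! Write `N` for the alphabet size, and `DX`, `DY` for `2 ^ (-δX b)`, `2 ^ (-δY b)`. Density bounds
the marginals of the two laws on a set `S` by `DX ^ |S|` and `DY ^ |S|`. For a value `x`, consider
the biases of the parities of `g (x i, Y i)` over `i ∈ S`, restricted to an event `Y_J = w` with `J`
disjoint from `S`. By Fourier expansion, these biases determine the probability of every event
`g^I(x_I, Y_I) = z_I`, `Y_J = w`.

The average over `x` of the absolute bias is controlled by an XOR lemma: it is at most `(24 N² disc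
g) ^ |S| * DX ^ |S| * DY ^ (|S| + |J|)`. The `∞ → 1` norm of the sign matrix is at most `4 N² disc
g`. This norm is not handled directly under tensor powers. Grothendieck's inequality and a
Hahn–Banach separation first replace it, at the cost of a factor `6`, by an `L²` operator norm for
suitable probability weights, and such norms tensorize (`WeightedBound.tensor`). On product
probability spaces the `L²` norm is at most the sup norm, which returns to bounded functions.

Markov's inequality and a union bound over `S`, `J`, `w` then show that all but a small mass of `x`
satisfy `HasSmallBiases`. The union bound costs `(n N) ^ |J|`, far more than sparsification permits.
Taking a weighted geometric mean with the trivial bound `DY ^ |J|`, with weight `ε / 4`, reduces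
this cost to `2 ^ (ε b |J| / 2)` while the parities still decay like `(4 n) ^ (-|S|)`. For such `x`
the Fourier series is dominated by its empty term. The event for `I` then has probability at least
`2 ^ (-|I| - 1)`, and conditioning on it costs at most `ε b` bits of min-entropy per coordinate. -/

namespace Lifting

/-! ### Grothendieck's inequality -/

/-- The sign `(-1)^a` of a bit. -/
noncomputable def boolSign (a : Bool) : ℝ := if a then -1 else 1

@[simp] theorem boolSign_true : boolSign true = -1 := by simp [boolSign]
@[simp] theorem boolSign_false : boolSign false = 1 := by simp [boolSign]

theorem abs_boolSign (a : Bool) : |boolSign a| = 1 := by cases a <;> simp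

/-- The Rademacher sum with coefficients `u`. -/
noncomputable def rademacherSum {d : ℕ} (u : Fin d → ℝ) (e : Fin d → Bool) : ℝ :=
  ∑ k, u k * boolSign (e k)

theorem sum_fin_succ_bool {d : ℕ} (F : (Fin (d + 1) → Bool) → ℝ) :
    ∑ e, F e = ∑ e : Fin d → Bool, (F (Fin.cons true e) + F (Fin.cons false e)) := by
  rw [← (Fin.consEquiv fun _ => Bool).sum_comp, Fintype.sum_prod_type, Fintype.sum_bool,
    ← Finset.sum_add_distrib]
  rfl

theorem rademacherSum_cons {d : ℕ} (u : Fin (d + 1) → ℝ) (a : Bool) (e : Fin d → Bool) :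
    rademacherSum u (Fin.cons a e) = u 0 * boolSign a + rademacherSum (Fin.tail u) e := by
  simp [rademacherSum, Fin.sum_univ_succ, Fin.tail]

/-- Orthogonality of independent signs, summed over the cube instead of averaged; this realizes
inner products as correlations. -/
theorem sum_rademacherSum_mul {d : ℕ} (u v : Fin d → ℝ) :
    ∑ e, rademacherSum u e * rademacherSum v e = 2 ^ d * ∑ k, u k * v k := by
  induction d with
  | zero => simp [rademacherSum]
  | succ d ih =>
    rw [sum_fin_succ_bool, Fin.sum_univ_succ]
    have h := ih (Fin.tail u) (Fin.tail v)
    simp only [rademacherSum_cons, boolSign_true, boolSign_false]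
    calc _ = ∑ e : Fin d → Bool, (2 * (u 0 * v 0) +
            2 * (rademacherSum (Fin.tail u) e * rademacherSum (Fin.tail v) e)) :=
          Finset.sum_congr rfl fun e _ => by ring
      _ = _ := by
          rw [Finset.sum_add_distrib, Finset.sum_const, ← Finset.mul_sum, h]
          simp [Fin.tail]
          ring

/-- Averaging over one sign kills the odd powers and leaves `a⁴ + 6 a² S² + S⁴`. The constant `3`
makes this fit under `3 (a² + σ)²` with `2 a⁴` to spare. -/
theorem sum_rademacherSum_pow_four_le {d : ℕ} (u : Fin d → ℝ) :
    ∑ e, rademacherSum u e ^ 4 ≤ 3 * 2 ^ d * (∑ k, u k ^ 2) ^ 2 := by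
  induction d with
  | zero => simp [rademacherSum]
  | succ d ih =>
    rw [sum_fin_succ_bool, Fin.sum_univ_succ]
    have h := ih (Fin.tail u)
    have h2 := sum_rademacherSum_mul (Fin.tail u) (Fin.tail u)
    simp only [rademacherSum_cons, boolSign_true, boolSign_false]
    set σ := ∑ k : Fin d, u k.succ ^ 2 with hσ
    have hσ' : ∑ k, Fin.tail u k ^ 2 = σ := rfl
    have hσ2 : ∑ k, Fin.tail u k * Fin.tail u k = σ := by
      rw [← hσ']; exact Finset.sum_congr rfl fun _ _ => by ring
    rw [hσ2] at h2
    rw [hσ'] at h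
    calc _ = ∑ e : Fin d → Bool, (2 * u 0 ^ 4 +
            12 * u 0 ^ 2 * (rademacherSum (Fin.tail u) e * rademacherSum (Fin.tail u) e) +
            2 * rademacherSum (Fin.tail u) e ^ 4) :=
          Finset.sum_congr rfl fun e _ => by ring
      _ = 2 ^ d * (2 * u 0 ^ 4) + 12 * u 0 ^ 2 * (2 ^ d * σ) +
            2 * ∑ e, rademacherSum (Fin.tail u) e ^ 4 := by
          rw [Finset.sum_add_distrib, Finset.sum_add_distrib, ← Finset.mul_sum, ← Finset.mul_sum,
            ← Finset.mul_sum, h2]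
          simp
          ring
      _ ≤ 2 ^ d * (2 * u 0 ^ 4) + 12 * u 0 ^ 2 * (2 ^ d * σ) + 2 * (3 * 2 ^ d * σ ^ 2) := by
          gcongr
      _ ≤ _ := by
          have : 0 ≤ (2 : ℝ) ^ d * (4 * u 0 ^ 4) := by positivity
          rw [pow_succ 2 d]
          linear_combination this

/-- Truncation of a real number to `[-√3, √3]`. -/
noncomputable def truncate (t : ℝ) : ℝ := max (-√3) (min t (√3))

theorem abs_truncate_le (t : ℝ) : |truncate t| ≤ √3 := by
  have : 0 ≤ √3 := Real.sqrt_nonneg 3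
  rw [abs_le]
  exact ⟨le_max_left _ _, max_le (by linarith) (min_le_right _ _)⟩

theorem truncate_sq_le (t : ℝ) : truncate t ^ 2 ≤ t ^ 2 := by
  have : 0 ≤ √3 := Real.sqrt_nonneg 3
  rw [sq_le_sq, truncate]
  rcases le_total t (√3) with h | h
  · rw [min_eq_left h]
    rcases le_total (-√3) t with h' | h'
    · rw [max_eq_right h']
    · rw [max_eq_left h', abs_neg, abs_of_nonneg this, abs_of_nonpos (by linarith)]
      linarith
  · rw [min_eq_right h, max_eq_right (by linarith), abs_of_nonneg this, abs_of_nonneg (by linarith)]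
    exact h

/-- Beyond the cutoff, `|t| - √3 ≤ t² / (4√3)` is `(|t| - 2√3)² ≥ 0`. With fourth moment at most
`3`, the truncated tail has `L²` norm at most `1/4`. -/
theorem sub_truncate_sq_le (t : ℝ) : (t - truncate t) ^ 2 ≤ t ^ 4 / 48 := by
  have h0 : 0 < √3 := by positivity
  have h3 : √3 ^ 2 = 3 := Real.sq_sqrt (by norm_num)
  have key : |t - truncate t| ≤ t ^ 2 / (4 * √3) := by
    rw [le_div_iff₀ (by positivity), truncate]
    rcases le_total t (√3) with h | h
    · rw [min_eq_left h]
      rcases le_total (-√3) t with h' | h'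
      · rw [max_eq_right h']; simp; positivity
      · rw [max_eq_left h', abs_of_nonpos (by linarith)]
        nlinarith [sq_nonneg (t + 2 * √3)]
    · rw [min_eq_right h, max_eq_right (by linarith), abs_of_nonneg (by linarith)]
      nlinarith [sq_nonneg (t - 2 * √3)]
  calc (t - truncate t) ^ 2 = |t - truncate t| ^ 2 := (sq_abs _).symm
    _ ≤ (t ^ 2 / (4 * √3)) ^ 2 := by gcongr
    _ = t ^ 4 / 48 := by rw [div_pow, mul_pow, h3]; ring

section Grothendieck

variable {α β : Type*} [Fintype α] [Fintype β]

/-- `K` bounds the matrix `A` paired with any two families of vectors from the unit ball. -/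
def VectorBound (A : α → β → ℝ) (K : ℝ) : Prop :=
  ∀ (κ : Type) [Fintype κ] (u : α → κ → ℝ) (v : β → κ → ℝ),
    (∀ i, ∑ k, u i k ^ 2 ≤ 1) → (∀ j, ∑ k, v j k ^ 2 ≤ 1) →
      ∑ i, ∑ j, A i j * ∑ k, u i k * v j k ≤ K

theorem VectorBound.le_mul {A : α → β → ℝ} {K : ℝ} (hK : VectorBound A K)
    {κ : Type} [Fintype κ] {u : α → κ → ℝ} {v : β → κ → ℝ} {a b : ℝ} (ha : 0 ≤ a) (hb : 0 ≤ b)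
    (hu : ∀ i, ∑ k, u i k ^ 2 ≤ a ^ 2) (hv : ∀ j, ∑ k, v j k ^ 2 ≤ b ^ 2) :
    ∑ i, ∑ j, A i j * ∑ k, u i k * v j k ≤ K * (a * b) := by
  have zero : ∀ {w : κ → ℝ}, ∑ k, w k ^ 2 ≤ 0 ^ 2 → ∀ k, w k = 0 := by
    intro w hw k
    have h1 : w k ^ 2 ≤ ∑ k, w k ^ 2 :=
      Finset.single_le_sum (f := fun k => w k ^ 2) (fun _ _ => sq_nonneg _) (Finset.mem_univ k)
    exact pow_eq_zero_iff two_ne_zero |>.1 (le_antisymm (by linarith) (sq_nonneg _))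
  rcases ha.eq_or_lt with rfl | ha
  · simp [fun i => zero (hu i)]
  rcases hb.eq_or_lt with rfl | hb
  · simp [fun j => zero (hv j)]
  have h := hK κ (fun i k => u i k / a) (fun j k => v j k / b)
    (fun i => by
      simp only [div_pow]; rw [← Finset.sum_div, div_le_one (by positivity)]; exact hu i)
    (fun j => by
      simp only [div_pow]; rw [← Finset.sum_div, div_le_one (by positivity)]; exact hv j)
  have e : ∑ i, ∑ j, A i j * ∑ k, u i k / a * (v j k / b)
      = (∑ i, ∑ j, A i j * ∑ k, u i k * v j k) / (a * b) := by
    simp only [Finset.sum_div, Finset.mul_sum]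
    refine Finset.sum_congr rfl fun i _ => Finset.sum_congr rfl fun j _ =>
      Finset.sum_congr rfl fun k _ => ?_
    field_simp
  rw [e, div_le_iff₀ (by positivity)] at h
  exact h

theorem vectorBound_sum_abs (A : α → β → ℝ) : VectorBound A (∑ i, ∑ j, |A i j|) := by
  intro κ _ u v hu hv
  refine Finset.sum_le_sum fun i _ => Finset.sum_le_sum fun j _ => ?_
  have h : |∑ k, u i k * v j k| ≤ 1 := by
    rw [← sq_le_one_iff_abs_le_one]
    calc _ ≤ (∑ k, u i k ^ 2) * ∑ k, v j k ^ 2 := Finset.sum_mul_sq_le_sq_mul_sq _ _ _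
      _ ≤ 1 * 1 := mul_le_mul (hu i) (hv j) (Finset.sum_nonneg fun _ _ => sq_nonneg _) zero_le_one
      _ = 1 := one_mul 1
  calc _ ≤ |A i j * ∑ k, u i k * v j k| := le_abs_self _
    _ = |A i j| * |∑ k, u i k * v j k| := abs_mul _ _
    _ ≤ |A i j| * 1 := by gcongr
    _ = _ := mul_one _

/-- Truncating Rademacher sums improves any bound to half of itself plus a multiple of the
`∞ → 1` norm. -/
theorem VectorBound.improve {A : α → β → ℝ} {C K : ℝ}
    (hC : ∀ (s : α → ℝ) (t : β → ℝ), (∀ i, |s i| ≤ 1) → (∀ j, |t j| ≤ 1) →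
      ∑ i, ∑ j, A i j * (s i * t j) ≤ C)
    (hK : VectorBound A K) : VectorBound A (3 * C + K / 2) := by
  suffices H : ∀ (d : ℕ) (u : α → Fin d → ℝ) (v : β → Fin d → ℝ),
      (∀ i, ∑ k, u i k ^ 2 ≤ 1) → (∀ j, ∑ k, v j k ^ 2 ≤ 1) →
        ∑ i, ∑ j, A i j * ∑ k, u i k * v j k ≤ 3 * C + K / 2 by
    intro κ _ u v hu hv
    have e := (Fintype.equivFin κ).symm
    have := H _ (fun i k => u i (e k)) (fun j k => v j (e k))
      (fun i => by rw [e.sum_comp (fun k => u i k ^ 2)]; exact hu i)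
      (fun j => by rw [e.sum_comp (fun k => v j k ^ 2)]; exact hv j)
    simpa only [fun i j => e.sum_comp (fun k => u i k * v j k)] using this
  intro d u v hu hv
  set D : ℝ := 2 ^ d with hD
  have hD0 : 0 < D := by positivity
  have hsD : √D ^ 2 = D := Real.sq_sqrt hD0.le
  set G : α → (Fin d → Bool) → ℝ := fun i => rademacherSum (u i)
  set H : β → (Fin d → Bool) → ℝ := fun j => rademacherSum (v j)
  have sq_bound : ∀ w : Fin d → ℝ, ∑ k, w k ^ 2 ≤ 1 → ∑ e, rademacherSum w e ^ 2 ≤ √D ^ 2 := by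
    intro w hw
    have h := sum_rademacherSum_mul w w
    simp only [← pow_two] at h
    rw [h, hsD]
    nlinarith
  have tr_bound : ∀ w : Fin d → ℝ, ∑ k, w k ^ 2 ≤ 1 →
      ∑ e, truncate (rademacherSum w e) ^ 2 ≤ √D ^ 2 := fun w hw =>
    (Finset.sum_le_sum fun e _ => truncate_sq_le _).trans (sq_bound w hw)
  have rest_bound : ∀ w : Fin d → ℝ, ∑ k, w k ^ 2 ≤ 1 →
      ∑ e, (rademacherSum w e - truncate (rademacherSum w e)) ^ 2 ≤ (√D / 4) ^ 2 := by
    intro w hw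
    have h0 : 0 ≤ ∑ k, w k ^ 2 := Finset.sum_nonneg fun _ _ => sq_nonneg _
    calc _ ≤ ∑ e, rademacherSum w e ^ 4 / 48 := Finset.sum_le_sum fun e _ => sub_truncate_sq_le _
      _ = (∑ e, rademacherSum w e ^ 4) / 48 := by rw [Finset.sum_div]
      _ ≤ (3 * D * (∑ k, w k ^ 2) ^ 2) / 48 := by
          gcongr; exact sum_rademacherSum_pow_four_le w
      _ ≤ (3 * D * 1 ^ 2) / 48 := by gcongr
      _ = (√D / 4) ^ 2 := by rw [div_pow, hsD]; ring
  -- Telescoping `G H = G' H' + (G - G') H + G' (H - H')` with `G'`, `H'` the truncations.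
  have main : D * ∑ i, ∑ j, A i j * ∑ k, u i k * v j k
      = (∑ e, ∑ i, ∑ j, A i j * (truncate (G i e) * truncate (H j e)))
        + (∑ i, ∑ j, A i j * ∑ e, (G i e - truncate (G i e)) * H j e)
        + ∑ i, ∑ j, A i j * ∑ e, truncate (G i e) * (H j e - truncate (H j e)) := by
    rw [Finset.sum_comm (s := Finset.univ (α := Fin d → Bool)), Finset.mul_sum,
      ← Finset.sum_add_distrib, ← Finset.sum_add_distrib]
    refine Finset.sum_congr rfl fun i _ => ?_
    rw [Finset.sum_comm (s := Finset.univ (α := Fin d → Bool)), Finset.mul_sum,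
      ← Finset.sum_add_distrib, ← Finset.sum_add_distrib]
    refine Finset.sum_congr rfl fun j _ => ?_
    rw [mul_left_comm, ← sum_rademacherSum_mul, ← Finset.mul_sum, ← mul_add, ← mul_add,
      ← Finset.sum_add_distrib, ← Finset.sum_add_distrib]
    congr 1
    exact Finset.sum_congr rfl fun e _ => by simp only [G, H]; ring
  have h1 : ∑ e, ∑ i, ∑ j, A i j * (truncate (G i e) * truncate (H j e)) ≤ D * (3 * C) := by
    have h3 : (√3 : ℝ) * √3 = 3 := Real.mul_self_sqrt (by norm_num)
    have : ∀ e, ∑ i, ∑ j, A i j * (truncate (G i e) * truncate (H j e)) ≤ 3 * C := by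
      intro e
      have h := hC (fun i => truncate (G i e) / √3) (fun j => truncate (H j e) / √3)
        (fun i => by
          rw [abs_div, abs_of_pos (by positivity : 0 < √3), div_le_one (by positivity)]
          exact abs_truncate_le _)
        (fun j => by
          rw [abs_div, abs_of_pos (by positivity : 0 < √3), div_le_one (by positivity)]
          exact abs_truncate_le _)
      have e' : ∑ i, ∑ j, A i j * (truncate (G i e) * truncate (H j e))
          = 3 * ∑ i, ∑ j, A i j * (truncate (G i e) / √3 * (truncate (H j e) / √3)) := by
        simp only [Finset.mul_sum]
        refine Finset.sum_congr rfl fun i _ => Finset.sum_congr rfl fun j _ => ?_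
        rw [div_mul_div_comm, h3]; ring
      rw [e']; linarith
    calc _ ≤ ∑ _e : Fin d → Bool, 3 * C := Finset.sum_le_sum fun e _ => this e
      _ = _ := by simp [hD]
  -- Functions on the cube are again vectors, now in dimension `2 ^ d`, so `K` itself bounds the two
  -- error terms, by `K / 4` each after normalization. This is why `VectorBound` allows every finite
  -- dimension.
  have h2 := hK.le_mul (κ := Fin d → Bool) (by positivity : 0 ≤ √D / 4) (Real.sqrt_nonneg D)
    (fun i => rest_bound (u i) (hu i)) (fun j => sq_bound (v j) (hv j))
  have h3 := hK.le_mul (κ := Fin d → Bool) (Real.sqrt_nonneg D) (by positivity : 0 ≤ √D / 4)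
    (fun i => tr_bound (u i) (hu i)) (fun j => rest_bound (v j) (hv j))
  have hsD' : √D * √D = D := Real.mul_self_sqrt hD0.le
  have h2' : K * (√D / 4 * √D) = D * (K / 4) := by
    rw [show K * (√D / 4 * √D) = (√D * √D) * (K / 4) by ring, hsD']
  have h3' : K * (√D * (√D / 4)) = D * (K / 4) := by
    rw [show K * (√D * (√D / 4)) = (√D * √D) * (K / 4) by ring, hsD']
  rw [h2'] at h2
  rw [h3'] at h3
  refine le_of_mul_le_mul_left ?_ hD0
  rw [main]
  have : D * (3 * C + K / 2) = D * (3 * C) + D * (K / 4) + D * (K / 4) := by ring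
  rw [this]
  exact add_le_add (add_le_add h1 h2) h3

/-- Grothendieck's inequality, with constant `6`. -/
theorem grothendieck_inequality {A : α → β → ℝ} {C : ℝ}
    (hC : ∀ (s : α → ℝ) (t : β → ℝ), (∀ i, |s i| ≤ 1) → (∀ j, |t j| ≤ 1) →
      ∑ i, ∑ j, A i j * (s i * t j) ≤ C) :
    VectorBound A (6 * C) := by
  set s : Set ℝ := {K | VectorBound A K}
  have hne : s.Nonempty := ⟨_, vectorBound_sum_abs A⟩
  have hbdd : BddBelow s := by
    refine ⟨0, fun K hK => ?_⟩
    have := hK Empty (fun _ _ => 0) (fun _ _ => 0) (by simp) (by simp)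
    simpa using this
  -- The least bound is attained, so improving it gives `K ≤ 3 C + K / 2`, hence `K ≤ 6 C`.
  have hmem : VectorBound A (sInf s) := fun κ _ u v hu hv =>
    le_csInf hne fun K hK => hK κ u v hu hv
  have h1 : sInf s ≤ 3 * C + sInf s / 2 := csInf_le hbdd (hmem.improve hC)
  have h2 : sInf s ≤ 6 * C := by linarith
  exact fun κ _ u v hu hv => (hmem κ u v hu hv).trans h2

end Grothendieck

/-! ### Factorization of matrices with small `∞ → 1` norm -/

section Factorization

variable {α β : Type*} [Fintype α] [Fintype β]

/-- The bilinear form of `A` is bounded by `T` with respect to the `L²` norms with weights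
`μ` and `ν`. -/
def WeightedBound (A : α → β → ℝ) (μ : α → ℝ) (ν : β → ℝ) (T : ℝ) : Prop :=
  ∀ (x : α → ℝ) (y : β → ℝ),
    ∑ i, ∑ j, A i j * (x i * y j) ≤ T * (√(∑ i, μ i * x i ^ 2) * √(∑ j, ν j * y j ^ 2))

theorem VectorBound.nonneg {A : α → β → ℝ} {K : ℝ} (hK : VectorBound A K) : 0 ≤ K := by
  simpa using hK Empty (fun _ _ => 0) (fun _ _ => 0) (by simp) (by simp)

/-- The cone of the functions `(i, j) ↦ K/2 (∑ₖ uᵢₖ² + ∑ₖ vⱼₖ²) - ∑ Aᵢⱼ ⟨uᵢ, vⱼ⟩`. -/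
def defectCone (A : α → β → ℝ) (K : ℝ) : Set (α × β → ℝ) :=
  {w | ∃ (κ : Type) (_ : Fintype κ) (u : α → κ → ℝ) (v : β → κ → ℝ), ∀ p,
    w p = K / 2 * (∑ k, u p.1 k ^ 2 + ∑ k, v p.2 k ^ 2) - ∑ i, ∑ j, A i j * ∑ k, u i k * v j k}

/-- Concatenating two vector families, scaled by `√a` and `√a'`, adds their Gram matrices with
weights `a` and `a'`. -/
theorem convex_defectCone (A : α → β → ℝ) (K : ℝ) : Convex ℝ (defectCone A K) := by
  rintro w ⟨κ, _, u, v, h⟩ w' ⟨κ', _, u', v', h'⟩ a a' ha ha' -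
  refine ⟨κ ⊕ κ', inferInstance, fun i => Sum.elim (fun k => √a * u i k) (fun k => √a' * u' i k),
    fun j => Sum.elim (fun k => √a * v j k) (fun k => √a' * v' j k), fun p => ?_⟩
  have e : ∀ i j, ∑ k : κ ⊕ κ', Sum.elim (fun k => √a * u i k) (fun k => √a' * u' i k) k *
      Sum.elim (fun k => √a * v j k) (fun k => √a' * v' j k) k
        = a * ∑ k, u i k * v j k + a' * ∑ k, u' i k * v' j k := by
    intro i j
    simp only [Fintype.sum_sum_type, Sum.elim_inl, Sum.elim_inr, Finset.mul_sum]
    congr 1 <;> refine Finset.sum_congr rfl fun k _ => ?_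
    · linear_combination (u i k * v j k) * Real.mul_self_sqrt ha
    · linear_combination (u' i k * v' j k) * Real.mul_self_sqrt ha'
  simp only [Pi.add_apply, Pi.smul_apply, smul_eq_mul, h, h', e]
  simp only [Fintype.sum_sum_type, Sum.elim_inl, Sum.elim_inr, mul_pow, Real.sq_sqrt ha,
    Real.sq_sqrt ha', mul_add, Finset.sum_add_distrib, mul_left_comm _ a, mul_left_comm _ a',
    ← Finset.mul_sum]
  ring

/-- Evaluate where both norms are maximal: the vector bound there is `K` times a geometric mean, and
AM-GM concludes. -/
theorem VectorBound.exists_nonneg_of_mem_defectCone [Nonempty α] [Nonempty β] {A : α → β → ℝ}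
    {K : ℝ} (hK : VectorBound A K) {w : α × β → ℝ} (hw : w ∈ defectCone A K) : ∃ p, 0 ≤ w p := by
  obtain ⟨κ, _, u, v, h⟩ := hw
  obtain ⟨i, hi⟩ := Finite.exists_max fun i => ∑ k, u i k ^ 2
  obtain ⟨j, hj⟩ := Finite.exists_max fun j => ∑ k, v j k ^ 2
  refine ⟨(i, j), ?_⟩
  rw [h]
  simp only
  set a := ∑ k, u i k ^ 2
  set b := ∑ k, v j k ^ 2
  have ha : 0 ≤ a := Finset.sum_nonneg fun _ _ => sq_nonneg _
  have hb : 0 ≤ b := Finset.sum_nonneg fun _ _ => sq_nonneg _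
  have h1 := hK.le_mul (u := u) (v := v) (Real.sqrt_nonneg a) (Real.sqrt_nonneg b)
    (fun i => (hi i).trans (Real.sq_sqrt ha).ge) (fun j => (hj j).trans (Real.sq_sqrt hb).ge)
  have h2 : 2 * (√a * √b) ≤ a + b := by
    nlinarith [sq_nonneg (√a - √b), Real.sq_sqrt ha, Real.sq_sqrt hb]
  nlinarith [hK.nonneg]

/-- Separating the defect cone from the open negative orthant gives a positive functional, that is,
a probability `l` on `α × β` after normalization; the weights are its marginals. One-dimensional
families then yield the bound. -/
theorem VectorBound.exists_weights [Nonempty α] [Nonempty β] {A : α → β → ℝ} {K : ℝ}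
    (hK : VectorBound A K) :
    ∃ (μ : α → ℝ) (ν : β → ℝ), (∀ i, 0 ≤ μ i) ∧ (∀ j, 0 ≤ ν j) ∧ ∑ i, μ i = 1 ∧ ∑ j, ν j = 1 ∧
      WeightedBound A μ ν K := by
  classical
  have hopen : IsOpen (Set.pi Set.univ fun _ : α × β => Set.Iio (0 : ℝ)) :=
    isOpen_set_pi Set.finite_univ fun _ _ => isOpen_Iio
  have hconv : Convex ℝ (Set.pi Set.univ fun _ : α × β => Set.Iio (0 : ℝ)) :=
    convex_pi fun _ _ => convex_Iio 0
  have hdisj : Disjoint (Set.pi Set.univ fun _ : α × β => Set.Iio (0 : ℝ)) (defectCone A K) := by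
    rw [Set.disjoint_left]
    intro w hw hw'
    obtain ⟨p, hp⟩ := hK.exists_nonneg_of_mem_defectCone hw'
    exact absurd (hw p trivial) (not_lt.2 hp)
  obtain ⟨f, c, hf, hc⟩ := geometric_hahn_banach_open hconv hopen (convex_defectCone A K) hdisj
  have hc0 : c ≤ 0 := by
    have : (0 : α × β → ℝ) ∈ defectCone A K :=
      ⟨Empty, inferInstance, fun _ _ => 0, fun _ _ => 0, fun p => by simp⟩
    simpa using hc _ this
  have hf1 : 0 < f 1 := by
    have := hf (-1) fun p _ => by simp
    rw [map_neg] at this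
    linarith
  have hpos : ∀ w ∈ defectCone A K, 0 ≤ f w := by
    intro w hw
    by_contra! hneg
    -- This negative constant function has the same `f`-value as `w`, so it would lie on both sides
    -- of the separation.
    have h1 := hf ((f w / f 1) • (1 : α × β → ℝ)) fun p _ => by
      simpa using div_neg_of_neg_of_pos hneg hf1
    rw [map_smul, smul_eq_mul, div_mul_cancel₀ _ hf1.ne'] at h1
    exact absurd (hc w hw) (not_le.2 h1)
  set l : α × β → ℝ := fun p => f (Pi.single p 1) / f 1 with hl
  have hl0 : ∀ p, 0 ≤ l p := by
    intro p
    refine div_nonneg ?_ hf1.le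
    by_contra! hneg
    -- A strictly negative function on which `f` vanishes, contradicting `f < c ≤ 0`.
    have h1 := hf (-Pi.single p 1 + (f (Pi.single p 1) / f 1) • (1 : α × β → ℝ)) fun q _ => by
      have h2 : (0 : ℝ) ≤ (Pi.single p 1 : α × β → ℝ) q := by
        rw [Pi.single_apply]; split_ifs <;> norm_num
      have h3 := div_neg_of_neg_of_pos hneg hf1
      simp only [Pi.add_apply, Pi.neg_apply, Pi.smul_apply, Pi.one_apply, smul_eq_mul, mul_one,
        Set.mem_Iio]
      linarith
    rw [map_add, map_neg, map_smul, smul_eq_mul, div_mul_cancel₀ _ hf1.ne'] at h1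
    linarith
  have hfl : ∀ w, f w = f 1 * ∑ p, l p * w p := by
    intro w
    conv_lhs => rw [pi_eq_sum_univ' w]
    rw [map_sum, Finset.mul_sum]
    refine Finset.sum_congr rfl fun p _ => ?_
    rw [map_smul, smul_eq_mul, hl]
    field_simp
  have hl1 : ∑ p, l p = 1 := by
    have h := hfl 1
    simp only [Pi.one_apply, mul_one] at h
    exact mul_left_cancel₀ hf1.ne' (by rw [← h, mul_one])
  refine ⟨fun i => ∑ j, l (i, j), fun j => ∑ i, l (i, j),
    fun i => Finset.sum_nonneg fun _ _ => hl0 _, fun j => Finset.sum_nonneg fun _ _ => hl0 _,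
    by rw [← hl1, Fintype.sum_prod_type], by rw [← hl1, Fintype.sum_prod_type_right],
    fun x y => ?_⟩
  have key : ∀ (x : α → ℝ) (y : β → ℝ), ∑ i, ∑ j, A i j * (x i * y j) ≤
      K / 2 * (∑ i, (∑ j, l (i, j)) * x i ^ 2 + ∑ j, (∑ i, l (i, j)) * y j ^ 2) := by
    intro x y
    have h := hpos (fun p => K / 2 * (x p.1 ^ 2 + y p.2 ^ 2) - ∑ i, ∑ j, A i j * (x i * y j))
      ⟨Unit, inferInstance, fun i _ => x i, fun j _ => y j, fun p => by simp⟩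
    rw [hfl] at h
    have h' := nonneg_of_mul_nonneg_right h hf1
    have e1 : ∑ p, l p * x p.1 ^ 2 = ∑ i, (∑ j, l (i, j)) * x i ^ 2 := by
      simp [Fintype.sum_prod_type, Finset.sum_mul]
    have e2 : ∑ p, l p * y p.2 ^ 2 = ∑ j, (∑ i, l (i, j)) * y j ^ 2 := by
      simp [Fintype.sum_prod_type_right, Finset.sum_mul]
    simp only [mul_sub, Finset.sum_sub_distrib, ← Finset.sum_mul, hl1, mul_left_comm _ (K / 2),
      ← Finset.mul_sum, mul_add, Finset.sum_add_distrib, e1, e2] at h'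
    linarith
  set a := ∑ i, (∑ j, l (i, j)) * x i ^ 2
  set b := ∑ j, (∑ i, l (i, j)) * y j ^ 2
  have ha : 0 ≤ a :=
    Finset.sum_nonneg fun i _ => mul_nonneg (Finset.sum_nonneg fun _ _ => hl0 _) (sq_nonneg _)
  have hb : 0 ≤ b :=
    Finset.sum_nonneg fun i _ => mul_nonneg (Finset.sum_nonneg fun _ _ => hl0 _) (sq_nonneg _)
  -- Rescaling `x` and `y` turns the arithmetic mean in `key` into a geometric mean; the shift `d >
  -- 0` allows for zero norms.
  have lim : Filter.Tendsto (fun d => K * (√(a + d) * √(b + d))) (nhdsWithin 0 (Set.Ioi 0))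
      (nhds (K * (√a * √b))) := by
    have : Continuous fun d => K * (√(a + d) * √(b + d)) := by fun_prop
    simpa using (this.tendsto 0).mono_left nhdsWithin_le_nhds
  refine ge_of_tendsto lim (Filter.eventually_of_mem self_mem_nhdsWithin fun d (hd : 0 < d) => ?_)
  have ha' : 0 < √(a + d) := by positivity
  have hb' : 0 < √(b + d) := by positivity
  have h := key (fun i => x i / √(a + d)) (fun j => y j / √(b + d))
  have e0 : ∑ i, ∑ j, A i j * (x i / √(a + d) * (y j / √(b + d)))
      = (∑ i, ∑ j, A i j * (x i * y j)) / (√(a + d) * √(b + d)) := by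
    simp only [Finset.sum_div, div_mul_div_comm, mul_div_assoc]
  have e1 : ∑ i, (∑ j, l (i, j)) * (x i / √(a + d)) ^ 2 = a / (a + d) := by
    simp only [div_pow, Real.sq_sqrt (by positivity : 0 ≤ a + d), ← mul_div_assoc,
      ← Finset.sum_div]
    rfl
  have e2 : ∑ j, (∑ i, l (i, j)) * (y j / √(b + d)) ^ 2 = b / (b + d) := by
    simp only [div_pow, Real.sq_sqrt (by positivity : 0 ≤ b + d), ← mul_div_assoc,
      ← Finset.sum_div]
    rfl
  rw [e0, e1, e2, div_le_iff₀ (by positivity)] at h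
  refine h.trans (mul_le_mul_of_nonneg_right ?_ (by positivity))
  have h1 : a / (a + d) ≤ 1 := (div_le_one (by positivity)).2 (by linarith)
  have h2 : b / (b + d) ≤ 1 := (div_le_one (by positivity)).2 (by linarith)
  nlinarith [hK.nonneg]

end Factorization

/-! ### Tensor powers -/

section Tensor

variable {α β α' β' : Type*} [Fintype α] [Fintype β] [Fintype α'] [Fintype β']

theorem WeightedBound.comp_equiv {A : α → β → ℝ} {μ : α → ℝ} {ν : β → ℝ} {T : ℝ}
    (h : WeightedBound A μ ν T) (e : α' ≃ α) (e' : β' ≃ β) :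
    WeightedBound (fun i j => A (e i) (e' j)) (μ ∘ e) (ν ∘ e') T := by
  intro x y
  have := h (x ∘ e.symm) (y ∘ e'.symm)
  rw [← e.sum_comp, ← e.sum_comp, ← e'.sum_comp] at this
  simp only [← e'.sum_comp, Function.comp_apply, Equiv.symm_apply_apply] at this
  exact this

/-- Apply `A` to each slice of `x` in the first variable, then `A'` for each fixed `j`, and combine
by Cauchy–Schwarz over `ν`. -/
theorem WeightedBound.tensor {A : α → β → ℝ} {μ : α → ℝ} {ν : β → ℝ} {T : ℝ}
    {A' : α' → β' → ℝ} {μ' : α' → ℝ} {ν' : β' → ℝ} {T' : ℝ}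
    (h : WeightedBound A μ ν T) (h' : WeightedBound A' μ' ν' T') (hT : 0 ≤ T) (hT' : 0 ≤ T')
    (hμ : ∀ i, 0 ≤ μ i) (hν : ∀ j, 0 ≤ ν j) (hμ' : ∀ i, 0 ≤ μ' i) (hν' : ∀ j, 0 ≤ ν' j) :
    WeightedBound (fun (p : α × α') (q : β × β') => A p.1 q.1 * A' p.2 q.2)
      (fun p => μ p.1 * μ' p.2) (fun q => ν q.1 * ν' q.2) (T * T') := by
  classical
  intro x y
  -- The density with respect to `ν` of the image of the slice. Where `ν j = 0` the division is
  -- junk, but testing against a point mass at `j` shows that the image vanishes there.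
  set r : α' → β → ℝ := fun k j => (∑ i, A i j * x (i, k)) / ν j with hr
  have hνr : ∀ k j, ν j * r k j = ∑ i, A i j * x (i, k) := by
    intro k j
    by_cases h0 : ν j = 0
    · have h1 := h (fun i => x (i, k)) (Pi.single j (∑ i, A i j * x (i, k)))
      have e1 : ∑ j', ν j' * (Pi.single j (∑ i, A i j * x (i, k)) : β → ℝ) j' ^ 2 = 0 := by
        refine Finset.sum_eq_zero fun j' _ => ?_
        by_cases hj : j' = j
        · rw [hj, h0, zero_mul]
        · rw [Pi.single_eq_of_ne hj]; ring
      have e2 : ∑ i, ∑ j', A i j' * (x (i, k) * (Pi.single j (∑ i, A i j * x (i, k)) : β → ℝ) j')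
          = (∑ i, A i j * x (i, k)) * ∑ i, A i j * x (i, k) := by
        rw [Finset.sum_mul]
        refine Finset.sum_congr rfl fun i _ => ?_
        rw [Finset.sum_eq_single j]
        · rw [Pi.single_eq_same, mul_assoc]
        · intro j' _ hj; rw [Pi.single_eq_of_ne hj]; ring
        · simp
      rw [e1, e2, Real.sqrt_zero, mul_zero, mul_zero] at h1
      rw [h0, zero_mul]
      exact (mul_self_eq_zero.1 (le_antisymm h1 (mul_self_nonneg _))).symm
    · rw [hr]; field_simp
  have hr2 : ∀ k, ∑ j, ν j * r k j ^ 2 ≤ T ^ 2 * ∑ i, μ i * x (i, k) ^ 2 := by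
    intro k
    -- Duality: testing against `r k` itself bounds its `L²(ν)` norm.
    have h1 := h (fun i => x (i, k)) (r k)
    have e1 : ∑ i, ∑ j, A i j * (x (i, k) * r k j) = ∑ j, ν j * r k j ^ 2 := by
      rw [Finset.sum_comm]
      refine Finset.sum_congr rfl fun j _ => ?_
      rw [pow_two, ← mul_assoc, hνr, Finset.sum_mul]
      exact Finset.sum_congr rfl fun i _ => by ring
    rw [e1] at h1
    set R := ∑ j, ν j * r k j ^ 2
    set P := ∑ i, μ i * x (i, k) ^ 2
    have hR : 0 ≤ R := Finset.sum_nonneg fun j _ => mul_nonneg (hν j) (sq_nonneg _)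
    have hP : 0 ≤ P := Finset.sum_nonneg fun j _ => mul_nonneg (hμ j) (sq_nonneg _)
    rcases hR.eq_or_lt with h0 | h0
    · rw [← h0]; positivity
    · have hs : 0 < √R := Real.sqrt_pos.2 h0
      have h2 : √R ≤ T * √P := by
        refine le_of_mul_le_mul_right ?_ hs
        rw [Real.mul_self_sqrt hR]; linarith
      calc R = √R ^ 2 := (Real.sq_sqrt hR).symm
        _ ≤ (T * √P) ^ 2 := by gcongr
        _ = T ^ 2 * P := by rw [mul_pow, Real.sq_sqrt hP]
  have hRk : ∀ j, 0 ≤ ∑ k, μ' k * r k j ^ 2 := fun j =>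
    Finset.sum_nonneg fun k _ => mul_nonneg (hμ' k) (sq_nonneg _)
  have hQl : ∀ j, 0 ≤ ∑ l, ν' l * y (j, l) ^ 2 := fun j =>
    Finset.sum_nonneg fun l _ => mul_nonneg (hν' l) (sq_nonneg _)
  calc ∑ p : α × α', ∑ q : β × β', A p.1 q.1 * A' p.2 q.2 * (x p * y q)
      = ∑ j, ν j * ∑ k, ∑ l, A' k l * (r k j * y (j, l)) := by
        simp only [Fintype.sum_prod_type]
        have e : ∀ j, ν j * ∑ k, ∑ l, A' k l * (r k j * y (j, l))
            = ∑ k, ∑ l, ∑ i, A i j * A' k l * (x (i, k) * y (j, l)) := by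
          intro j
          simp only [Finset.mul_sum]
          refine Finset.sum_congr rfl fun k _ => Finset.sum_congr rfl fun l _ => ?_
          rw [show ν j * (A' k l * (r k j * y (j, l))) = (ν j * r k j) * (A' k l * y (j, l)) by ring,
            hνr, Finset.sum_mul]
          exact Finset.sum_congr rfl fun i _ => by ring
        simp only [e]
        rw [Finset.sum_comm]
        calc _ = ∑ k, ∑ j, ∑ l, ∑ i, A i j * A' k l * (x (i, k) * y (j, l)) := by
              refine Finset.sum_congr rfl fun k _ => ?_
              rw [Finset.sum_comm]
              refine Finset.sum_congr rfl fun j _ => ?_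
              rw [Finset.sum_comm]
          _ = _ := Finset.sum_comm
    _ ≤ ∑ j, ν j * (T' * (√(∑ k, μ' k * r k j ^ 2) * √(∑ l, ν' l * y (j, l) ^ 2))) :=
        Finset.sum_le_sum fun j _ => mul_le_mul_of_nonneg_left (h' _ _) (hν j)
    _ = T' * ∑ j, √(ν j * ∑ k, μ' k * r k j ^ 2) * √(ν j * ∑ l, ν' l * y (j, l) ^ 2) := by
        rw [Finset.mul_sum]
        refine Finset.sum_congr rfl fun j _ => ?_
        rw [Real.sqrt_mul (hν j), Real.sqrt_mul (hν j), mul_mul_mul_comm, Real.mul_self_sqrt (hν j)]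
        ring
    _ ≤ T' * (√(∑ j, ν j * ∑ k, μ' k * r k j ^ 2) * √(∑ j, ν j * ∑ l, ν' l * y (j, l) ^ 2)) := by
        gcongr
        exact Real.sum_sqrt_mul_sqrt_le _ (fun j => mul_nonneg (hν j) (hRk j))
          (fun j => mul_nonneg (hν j) (hQl j))
    _ ≤ T' * (√(T ^ 2 * ∑ p : α × α', μ p.1 * μ' p.2 * x p ^ 2) *
          √(∑ q : β × β', ν q.1 * ν' q.2 * y q ^ 2)) := by
        gcongr
        · calc ∑ j, ν j * ∑ k, μ' k * r k j ^ 2 = ∑ k, μ' k * ∑ j, ν j * r k j ^ 2 := by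
                simp only [Finset.mul_sum]
                rw [Finset.sum_comm]
                exact Finset.sum_congr rfl fun k _ => Finset.sum_congr rfl fun j _ => by ring
            _ ≤ ∑ k, μ' k * (T ^ 2 * ∑ i, μ i * x (i, k) ^ 2) :=
                Finset.sum_le_sum fun k _ => mul_le_mul_of_nonneg_left (hr2 k) (hμ' k)
            _ = _ := by
                simp only [Fintype.sum_prod_type_right, Finset.mul_sum]
                exact Finset.sum_congr rfl fun k _ => Finset.sum_congr rfl fun i _ => by ring
        · simp only [Fintype.sum_prod_type, Finset.mul_sum, mul_assoc]
          exact le_rfl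
    _ = _ := by
        rw [Real.sqrt_mul (sq_nonneg T), Real.sqrt_sq hT]
        ring

theorem WeightedBound.pow {A : α → β → ℝ} {μ : α → ℝ} {ν : β → ℝ} {T : ℝ}
    (h : WeightedBound A μ ν T) (hT : 0 ≤ T) (hμ : ∀ i, 0 ≤ μ i) (hν : ∀ j, 0 ≤ ν j) (m : ℕ) :
    WeightedBound (fun (x : Fin m → α) (y : Fin m → β) => ∏ i, A (x i) (y i))
      (fun x => ∏ i, μ (x i)) (fun y => ∏ i, ν (y i)) (T ^ m) := by
  induction m with
  | zero =>
    intro x y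
    simp [Real.sqrt_sq_eq_abs, ← abs_mul, le_abs_self]
  | succ m ih =>
    have := (h.tensor ih hT (by positivity) hμ hν
      (fun x => Finset.prod_nonneg fun i _ => hμ _)
      (fun y => Finset.prod_nonneg fun i _ => hν _)).comp_equiv
        (Fin.consEquiv fun _ : Fin (m + 1) => α).symm (Fin.consEquiv fun _ : Fin (m + 1) => β).symm
    rw [pow_succ']
    convert this using 1
    · ext x y
      simp [Fin.prod_univ_succ, Fin.consEquiv, Fin.tail]
    · ext x
      simp [Fin.prod_univ_succ, Fin.consEquiv, Fin.tail]
    · ext x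
      simp [Fin.prod_univ_succ, Fin.consEquiv, Fin.tail]

theorem sum_prod_weights {ι : Type*} [Fintype ι] [DecidableEq ι] (μ : α → ℝ) (h : ∑ i, μ i = 1) :
    ∑ x : ι → α, ∏ i, μ (x i) = 1 := by
  have := Fintype.prod_sum fun (_ : ι) a => μ a
  simpa [h] using this.symm

/-- XOR lemma: the tensor power of a matrix with a small `∞ → 1` norm has a small `∞ → 1` norm. -/
theorem sum_tensor_power_le [Nonempty α] [Nonempty β] {ι : Type*} [Fintype ι] [DecidableEq ι]
    {A : α → β → ℝ} {C : ℝ}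
    (hC : ∀ (s : α → ℝ) (t : β → ℝ), (∀ i, |s i| ≤ 1) → (∀ j, |t j| ≤ 1) →
      ∑ i, ∑ j, A i j * (s i * t j) ≤ C)
    {p : (ι → α) → ℝ} {q : (ι → β) → ℝ} {a b : ℝ} (ha : 0 ≤ a) (hb : 0 ≤ b)
    (hp : ∀ x, |p x| ≤ a) (hq : ∀ y, |q y| ≤ b) :
    ∑ x, ∑ y, (∏ i, A (x i) (y i)) * (p x * q y) ≤ (6 * C) ^ Fintype.card ι * (a * b) := by
  have hK := grothendieck_inequality hC
  obtain ⟨μ, ν, hμ, hν, hμ1, hν1, hW⟩ := hK.exists_weights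
  have e := Fintype.equivFin ι
  have h := (hW.pow hK.nonneg hμ hν (Fintype.card ι)).comp_equiv
    (e.arrowCongr (Equiv.refl α)) (e.arrowCongr (Equiv.refl β)) p q
  have e1 : ∀ (x : ι → α) (y : ι → β),
      ∏ i, A (e.arrowCongr (Equiv.refl α) x i) (e.arrowCongr (Equiv.refl β) y i)
        = ∏ i, A (x i) (y i) := fun x y => by
    rw [← e.prod_comp]; simp
  have e2 : ∀ (x : ι → α), ((fun x => ∏ i, μ (x i)) ∘ (e.arrowCongr (Equiv.refl α))) x
      = ∏ i, μ (x i) := fun x => by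
    rw [Function.comp_apply, ← e.prod_comp]; simp
  have e3 : ∀ (y : ι → β), ((fun x => ∏ i, ν (x i)) ∘ (e.arrowCongr (Equiv.refl β))) y
      = ∏ i, ν (y i) := fun x => by
    rw [Function.comp_apply, ← e.prod_comp]; simp
  simp only [e1, e2, e3] at h
  refine h.trans (mul_le_mul_of_nonneg_left ?_ (pow_nonneg hK.nonneg _))
  refine mul_le_mul ?_ ?_ (Real.sqrt_nonneg _) ha
  · rw [Real.sqrt_le_left ha]
    calc _ ≤ ∑ x : ι → α, (∏ i, μ (x i)) * a ^ 2 := by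
          refine Finset.sum_le_sum fun x _ => mul_le_mul_of_nonneg_left ?_
            (Finset.prod_nonneg fun i _ => hμ _)
          rw [← sq_abs]; gcongr; exact hp x
      _ = a ^ 2 := by rw [← Finset.sum_mul, sum_prod_weights μ hμ1, one_mul]
  · rw [Real.sqrt_le_left hb]
    calc _ ≤ ∑ x : ι → β, (∏ i, ν (x i)) * b ^ 2 := by
          refine Finset.sum_le_sum fun x _ => mul_le_mul_of_nonneg_left ?_
            (Finset.prod_nonneg fun i _ => hν _)
          rw [← sq_abs]; gcongr; exact hq x
      _ = b ^ 2 := by rw [← Finset.sum_mul, sum_prod_weights ν hν1, one_mul]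

end Tensor

/-! ### Discrepancy and the `∞ → 1` norm -/

/-- Splitting by the sign of `c` bounds its `ℓ¹` norm by two subset sums. Used once per variable,
this accounts for the factor `4` between discrepancy and the `∞ → 1` norm. -/
theorem sum_mul_le_two_mul {β : Type*} [Fintype β] {c : β → ℝ} {D : ℝ}
    (h : ∀ B : Finset β, |∑ j ∈ B, c j| ≤ D) {t : β → ℝ} (ht : ∀ j, |t j| ≤ 1) :
    ∑ j, c j * t j ≤ 2 * D := by
  classical
  have h1 : ∑ j, c j * t j ≤ ∑ j, |c j| := Finset.sum_le_sum fun j _ =>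
    calc c j * t j ≤ |c j * t j| := le_abs_self _
      _ = |c j| * |t j| := abs_mul _ _
      _ ≤ |c j| * 1 := by gcongr; exact ht j
      _ = |c j| := mul_one _
  have h2 : ∑ j, |c j| = ∑ j with 0 ≤ c j, c j - ∑ j with ¬ 0 ≤ c j, c j := by
    rw [← Finset.sum_filter_add_sum_filter_not Finset.univ (fun j => 0 ≤ c j), sub_eq_add_neg,
      ← Finset.sum_neg_distrib]
    congr 1 <;> refine Finset.sum_congr rfl fun j hj => ?_
    · exact abs_of_nonneg (Finset.mem_filter.1 hj).2
    · exact abs_of_neg (not_le.1 (Finset.mem_filter.1 hj).2)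
  have h3 := (abs_le.1 (h {j | 0 ≤ c j})).2
  have h4 := (abs_le.1 (h {j | ¬ 0 ≤ c j})).1
  linarith

theorem abs_sum_sum_boolSign_le {Λ : Type*} [Fintype Λ] [Nonempty Λ] (g : Λ → Λ → Bool)
    (A B : Finset Λ) :
    |∑ u ∈ A, ∑ v ∈ B, boolSign (g u v)| ≤ (Fintype.card Λ : ℝ) ^ 2 * disc g := by
  have h := (isGreatest_disc g).2 ⟨(A, B), rfl⟩
  have hN : (0 : ℝ) < (Fintype.card Λ : ℝ) ^ 2 := by
    have : 0 < Fintype.card Λ := Fintype.card_pos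
    positivity
  simp only [rectDisc, ← sub_div, abs_div, abs_of_pos hN] at h
  rw [div_le_iff₀ hN, mul_comm] at h
  refine le_trans (le_of_eq ?_) h
  congr 1
  rw [← Finset.sum_product', Finset.natCast_card_filter, Finset.natCast_card_filter,
    ← Finset.sum_sub_distrib]
  refine Finset.sum_congr rfl fun p _ => ?_
  cases g p.1 p.2 <;> simp

theorem sum_boolSign_mul_le {Λ : Type*} [Fintype Λ] [Nonempty Λ] (g : Λ → Λ → Bool)
    {s t : Λ → ℝ} (hs : ∀ i, |s i| ≤ 1) (ht : ∀ j, |t j| ≤ 1) :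
    ∑ i, ∑ j, boolSign (g i j) * (s i * t j) ≤ 4 * ((Fintype.card Λ : ℝ) ^ 2 * disc g) := by
  set D := (Fintype.card Λ : ℝ) ^ 2 * disc g
  have h1 : ∀ {s : Λ → ℝ}, (∀ i, |s i| ≤ 1) → ∀ B : Finset Λ,
      ∑ j ∈ B, ∑ i, boolSign (g i j) * s i ≤ 2 * D := by
    intro s hs B
    have h := sum_mul_le_two_mul (c := fun i => ∑ j ∈ B, boolSign (g i j))
      (fun A => abs_sum_sum_boolSign_le g A B) hs
    rw [Finset.sum_comm]
    simpa only [Finset.sum_mul] using h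
  have h2 : ∀ B : Finset Λ, |∑ j ∈ B, ∑ i, boolSign (g i j) * s i| ≤ 2 * D := by
    intro B
    refine abs_le'.2 ⟨h1 hs B, ?_⟩
    have h := h1 (s := fun i => - s i) (fun i => by rw [abs_neg]; exact hs i) B
    simpa only [mul_neg, Finset.sum_neg_distrib] using h
  have h := sum_mul_le_two_mul h2 ht
  simp only [Finset.sum_mul] at h
  rw [Finset.sum_comm] at h
  calc _ = ∑ i, ∑ j, boolSign (g i j) * s i * t j := by simp only [mul_assoc]
    _ ≤ 2 * (2 * D) := h
    _ = 4 * D := by ring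

/-! ### Biases of parities of the gadget -/

section Bias

variable {ι Λ : Type*} [Fintype ι] [DecidableEq ι] [Fintype Λ] [DecidableEq Λ]

/-- Every set `I` of coordinates takes each value with weight at most `D ^ |I|`. -/
def MarginalBound (q : (ι → Λ) → ℝ) (D : ℝ) : Prop :=
  ∀ (I : Finset ι) (w : ι → Λ), ∑ y with ∀ i ∈ I, y i = w i, q y ≤ D ^ I.card

/-- The expectation of `∏_{i ∈ S} (-1)^{g (xᵢ, yᵢ)}` on the event `y_J = w`, for `y` of law `q`. -/
noncomputable def partialBias (g : Λ → Λ → Bool) (q : (ι → Λ) → ℝ) (S J : Finset ι) (w : J → Λ)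
    (x : ι → Λ) : ℝ :=
  ∑ y with J.restrict y = w, q y * ∏ i ∈ S, boolSign (g (x i) (y i))

theorem restrict_eq_restrict_iff {ι Λ : Type*} {S : Finset ι} {x y : ι → Λ} :
    S.restrict x = S.restrict y ↔ ∀ i ∈ S, x i = y i := by
  simp [funext_iff]

theorem MarginalBound.sum_restrict_le {q : (ι → Λ) → ℝ} {D : ℝ} (h : MarginalBound q D)
    (hD : 0 ≤ D) (I : Finset ι) (w : I → Λ) : ∑ y with I.restrict y = w, q y ≤ D ^ I.card := by
  by_cases hw : ∃ y₀ : ι → Λ, I.restrict y₀ = w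
  · obtain ⟨y₀, rfl⟩ := hw
    simpa only [restrict_eq_restrict_iff] using h I y₀
  · rw [Finset.sum_eq_zero]
    · positivity
    · exact fun y hy => absurd ⟨y, (Finset.mem_filter.1 hy).2⟩ hw

theorem MarginalBound.sum_restrict_restrict_le {q : (ι → Λ) → ℝ} {D : ℝ} (h : MarginalBound q D)
    (hD : 0 ≤ D) {S J : Finset ι} (hSJ : Disjoint S J) (w : J → Λ) (v : S → Λ) :
    ∑ y ∈ {y | J.restrict y = w} with S.restrict y = v, q y ≤ D ^ (S.card + J.card) := by
  rw [Finset.filter_filter]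
  by_cases hw : ∃ y₀ : ι → Λ, J.restrict y₀ = w ∧ S.restrict y₀ = v
  · obtain ⟨y₀, rfl, rfl⟩ := hw
    rw [← Finset.card_union_of_disjoint hSJ]
    refine le_trans (le_of_eq (Finset.sum_congr (Finset.filter_congr fun y _ => ?_) fun _ _ => rfl))
      (h (S ∪ J) y₀)
    rw [restrict_eq_restrict_iff, restrict_eq_restrict_iff]
    simp only [Finset.mem_union, or_imp, forall_and, and_comm]
  · rw [Finset.sum_eq_zero]
    · positivity
    · exact fun y hy => absurd ⟨y, (Finset.mem_filter.1 hy).2⟩ hw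

/-- Absorb the sign of the bias into `p` and push both weights forward to the coordinates in `S`.
Their densities are bounded by the marginal bounds, so the XOR lemma applies on `Λ ^ S`. -/
theorem sum_mul_abs_partialBias_le [Nonempty Λ] (g : Λ → Λ → Bool) {p q : (ι → Λ) → ℝ}
    {DX DY : ℝ} (hp0 : ∀ x, 0 ≤ p x) (hq0 : ∀ y, 0 ≤ q y) (hDX : 0 ≤ DX) (hDY : 0 ≤ DY)
    (hp : MarginalBound p DX) (hq : MarginalBound q DY) {S J : Finset ι} (hSJ : Disjoint S J)
    (w : J → Λ) :
    ∑ x, p x * |partialBias g q S J w x| ≤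
      (6 * (4 * ((Fintype.card Λ : ℝ) ^ 2 * disc g))) ^ S.card *
        (DX ^ S.card * DY ^ (S.card + J.card)) := by
  set sg : (ι → Λ) → ℝ := fun x => (SignType.sign (partialBias g q S J w x) : ℝ)
  have hsg : ∀ x, |sg x| ≤ 1 := fun x => by
    rcases lt_trichotomy (partialBias g q S J w x) 0 with h | h | h <;> simp [sg, h]
  have h := sum_tensor_power_le (ι := S) (A := fun u v => boolSign (g u v))
    (fun s t hs ht => sum_boolSign_mul_le g hs ht)
    (p := fun u => ∑ x with S.restrict x = u, p x * sg x)
    (q := fun v => ∑ y ∈ {y | J.restrict y = w} with S.restrict y = v, q y)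
    (pow_nonneg hDX S.card) (pow_nonneg hDY (S.card + J.card))
    (fun u => by
      refine (Finset.abs_sum_le_sum_abs _ _).trans
        (le_trans (Finset.sum_le_sum fun x _ => ?_) (hp.sum_restrict_le hDX S u))
      rw [abs_mul, abs_of_nonneg (hp0 x)]
      exact mul_le_of_le_one_right (hp0 x) (hsg x))
    (fun v => by
      rw [abs_of_nonneg (Finset.sum_nonneg fun y _ => hq0 y)]
      exact hq.sum_restrict_restrict_le hDY hSJ w v)
  rw [Fintype.card_coe] at h
  refine le_trans (le_of_eq ?_) h
  symm
  calc _ = ∑ u : S → Λ, ∑ x with S.restrict x = u, ∑ v : S → Λ,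
          ∑ y ∈ {y | J.restrict y = w} with S.restrict y = v,
            (∏ i ∈ S, boolSign (g (x i) (y i))) * (p x * sg x * q y) := by
        refine Finset.sum_congr rfl fun u _ => ?_
        rw [Finset.sum_comm]
        refine Finset.sum_congr rfl fun v _ => ?_
        rw [Finset.sum_mul_sum, Finset.mul_sum]
        refine Finset.sum_congr rfl fun x hx => ?_
        rw [Finset.mul_sum]
        refine Finset.sum_congr rfl fun y hy => ?_
        rw [← (Finset.mem_filter.1 hx).2, ← (Finset.mem_filter.1 hy).2, ← Finset.prod_coe_sort S]
        rfl
    _ = ∑ x, ∑ y with J.restrict y = w,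
          (∏ i ∈ S, boolSign (g (x i) (y i))) * (p x * sg x * q y) := by
        rw [Finset.sum_fiberwise]
        exact Finset.sum_congr rfl fun x _ => Finset.sum_fiberwise _ _ _
    _ = _ := by
        refine Finset.sum_congr rfl fun x _ => ?_
        rw [← sign_mul_self, partialBias, Finset.mul_sum, Finset.mul_sum]
        exact Finset.sum_congr rfl fun y _ => by simp only [sg, partialBias]; ring

theorem abs_partialBias_le (g : Λ → Λ → Bool) {q : (ι → Λ) → ℝ} {D : ℝ} (hq0 : ∀ y, 0 ≤ q y)
    (hD : 0 ≤ D) (hq : MarginalBound q D) (S J : Finset ι) (w : J → Λ) (x : ι → Λ) :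
    |partialBias g q S J w x| ≤ D ^ J.card := by
  refine (Finset.abs_sum_le_sum_abs _ _).trans
    (le_trans (Finset.sum_le_sum fun y _ => ?_) (hq.sum_restrict_le hD J w))
  rw [abs_mul, abs_of_nonneg (hq0 y), Finset.abs_prod]
  simp [abs_boolSign]

/-- Fourier expansion of the weight of the event `g^I(x_I, y_I) = z_I, y_J = w`. -/
theorem two_pow_mul_sum_eq (g : Λ → Λ → Bool) (q : (ι → Λ) → ℝ) (I J : Finset ι) (z : ι → Bool)
    (w : J → Λ) (x : ι → Λ) :
    2 ^ I.card * ∑ y with J.restrict y = w ∧ ∀ i ∈ I, g (x i) (y i) = z i, q y =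
      ∑ S ∈ I.powerset, (∏ i ∈ S, boolSign (z i)) * partialBias g q S J w x := by
  -- The sum factors over `i ∈ I` into `1 ± 1`, with `+` exactly when the bits agree.
  have key : ∀ y : ι → Λ, ∑ S ∈ I.powerset,
      (∏ i ∈ S, boolSign (z i)) * ∏ i ∈ S, boolSign (g (x i) (y i))
        = if ∀ i ∈ I, g (x i) (y i) = z i then 2 ^ I.card else 0 := by
    intro y
    simp only [← Finset.prod_mul_distrib]
    rw [← Finset.prod_one_add]
    split_ifs with h
    · rw [← Finset.prod_const]
      refine Finset.prod_congr rfl fun i hi => ?_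
      rw [h i hi]
      cases z i <;> norm_num
    · push Not at h
      obtain ⟨i, hi, hne⟩ := h
      refine Finset.prod_eq_zero hi ?_
      revert hne
      cases z i <;> cases g (x i) (y i) <;> simp
  simp only [partialBias, Finset.mul_sum]
  rw [Finset.sum_comm, ← Finset.filter_filter, Finset.sum_filter]
  refine Finset.sum_congr rfl fun y _ => ?_
  simp only [mul_left_comm _ (q y)]
  rw [← Finset.mul_sum, key]
  split_ifs <;> ring

/-! ### Good values -/

/-- All parities of the gadget at `x` have small bias, even on the events `y_J = w`. -/
def HasSmallBiases (g : Λ → Λ → Bool) (q : (ι → Λ) → ℝ) (D R M : ℝ) (x : ι → Λ) : Prop :=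
  ∀ S J : Finset ι, S.Nonempty → Disjoint S J → ∀ w : J → Λ,
    |partialBias g q S J w x| ≤ D ^ J.card * (R ^ J.card / M ^ S.card)

theorem sum_powerset_pow_card {ι : Type*} (I : Finset ι) (a : ℝ) :
    ∑ S ∈ I.powerset, a ^ S.card = (1 + a) ^ I.card := by
  have := Finset.prod_one_add (f := fun _ => a) I
  simpa using this.symm

theorem one_add_div_pow_le {a : ℝ} (ha : 0 ≤ a) {m n : ℕ} (hmn : m ≤ n) (hn : 0 < n) :
    (1 + a / n) ^ m ≤ Real.exp a := by
  have hn' : (0 : ℝ) < n := by exact_mod_cast hn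
  calc (1 + a / n) ^ m ≤ (1 + a / n) ^ n := pow_le_pow_right₀ (by simp; positivity) hmn
    _ ≤ Real.exp (a / n) ^ n := by
        gcongr; linarith [Real.add_one_le_exp (a / n)]
    _ = Real.exp a := by rw [← Real.exp_nat_mul]; congr 1; field_simp

open Classical in
/-- Markov's inequality and a union bound: most values have small biases. -/
theorem sum_not_hasSmallBiases_le [Nonempty Λ] (g : Λ → Λ → Bool) {p q : (ι → Λ) → ℝ}
    {DX DY M t : ℝ} {n : ℕ} (hn : 0 < n) (hcard : Fintype.card ι ≤ n)
    (hp0 : ∀ x, 0 ≤ p x) (hq0 : ∀ y, 0 ≤ q y) (hDX : 0 < DX) (hDY : 0 < DY) (hM : 0 < M)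
    (hp : MarginalBound p DX) (hq : MarginalBound q DY) (ht : t ≤ 1)
    (hbound : n * (6 * (4 * ((Fintype.card Λ : ℝ) ^ 2 * disc g)) * DX * DY * M) ≤ t) :
    ∑ x with ¬ HasSmallBiases g q DY (n * Fintype.card Λ) M x, p x ≤ 9 * t := by
  set N : ℝ := (Fintype.card Λ : ℝ) with hN
  have hN0 : 0 < N := by
    have : 0 < Fintype.card Λ := Fintype.card_pos
    positivity
  have hn0 : (0 : ℝ) < n := by exact_mod_cast hn
  set T := 6 * (4 * (N ^ 2 * disc g)) with hT
  have hT0 : 0 ≤ T := by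
    have : 0 ≤ disc g := (abs_nonneg _).trans ((isGreatest_disc g).2 ⟨(∅, ∅), rfl⟩)
    positivity
  have ht0 : 0 ≤ t := le_trans (by positivity) hbound
  set θ : Finset ι → Finset ι → ℝ := fun S J => DY ^ J.card * ((n * N) ^ J.card / M ^ S.card)
    with hθ
  have hθ0 : ∀ S J, 0 < θ S J := fun S J => by positivity
  set Φ : (ι → Λ) → ℝ := fun x => ∑ S ∈ Finset.univ.filter Finset.Nonempty, ∑ J ∈ Sᶜ.powerset,
    ∑ w : J → Λ, |partialBias g q S J w x| / θ S J with hΦ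
  have hΦ0 : ∀ x, 0 ≤ Φ x := fun x => Finset.sum_nonneg fun S _ => Finset.sum_nonneg fun J _ =>
    Finset.sum_nonneg fun w _ => div_nonneg (abs_nonneg _) (hθ0 S J).le
  have hbad : ∀ x, ¬ HasSmallBiases g q DY (n * N) M x → 1 ≤ Φ x := by
    intro x hx
    simp only [HasSmallBiases, not_forall, not_le] at hx
    obtain ⟨S, J, hS, hSJ, w, hlt⟩ := hx
    have h1 : 1 ≤ |partialBias g q S J w x| / θ S J := by
      rw [one_le_div (hθ0 S J)]; exact hlt.le
    have hJ : J ∈ Sᶜ.powerset := by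
      rw [Finset.mem_powerset, Finset.subset_compl_comm]
      intro i hi
      rw [Finset.mem_compl]
      exact Finset.disjoint_left.1 hSJ hi
    have hpos : ∀ (S J : Finset ι) (w : J → Λ), 0 ≤ |partialBias g q S J w x| / θ S J :=
      fun S J w => div_nonneg (abs_nonneg _) (hθ0 S J).le
    refine h1.trans (le_trans ?_ (Finset.single_le_sum (f := fun S : Finset ι => ∑ J ∈ Sᶜ.powerset,
      ∑ w : J → Λ, |partialBias g q S J w x| / θ S J)
      (fun S _ => Finset.sum_nonneg fun J _ => Finset.sum_nonneg fun w _ => hpos S J w)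
      (Finset.mem_filter.2 ⟨Finset.mem_univ S, hS⟩)))
    refine le_trans ?_ (Finset.single_le_sum (f := fun J : Finset ι =>
      ∑ w : J → Λ, |partialBias g q S J w x| / θ S J)
      (fun J _ => Finset.sum_nonneg fun w _ => hpos S J w) hJ)
    exact Finset.single_le_sum (f := fun w => |partialBias g q S J w x| / θ S J)
      (fun w _ => hpos S J w) (Finset.mem_univ w)
  have hterm : ∀ S J : Finset ι, Disjoint S J → ∀ w : J → Λ,
      ∑ x, p x * (|partialBias g q S J w x| / θ S J) ≤
        (T * DX * DY * M) ^ S.card / (n * N) ^ J.card := by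
    intro S J hSJ w
    have h := sum_mul_abs_partialBias_le g hp0 hq0 hDX.le hDY.le hp hq hSJ w
    rw [← hN, ← hT] at h
    simp only [← mul_div_assoc]
    rw [← Finset.sum_div, div_le_iff₀ (hθ0 S J)]
    refine h.trans (le_of_eq ?_)
    rw [hθ, mul_pow (T * DX * DY), mul_pow (T * DX), mul_pow T, pow_add]
    have : (n * N) ^ J.card ≠ 0 := by positivity
    have : M ^ S.card ≠ 0 := by positivity
    field_simp
  have he : Real.exp 1 ≤ 3 := Real.exp_one_lt_three.le
  have hsum : ∀ I : Finset ι, ∑ S ∈ I.powerset, (1 / (n : ℝ)) ^ S.card ≤ 3 := by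
    intro I
    rw [sum_powerset_pow_card]
    exact (one_add_div_pow_le zero_le_one ((Finset.card_le_univ I).trans hcard) hn).trans he
  calc ∑ x with ¬ HasSmallBiases g q DY (n * N) M x, p x
      ≤ ∑ x with ¬ HasSmallBiases g q DY (n * N) M x, p x * Φ x :=
        Finset.sum_le_sum fun x hx => le_mul_of_one_le_right (hp0 x)
          (hbad x (Finset.mem_filter.1 hx).2)
    _ ≤ ∑ x, p x * Φ x := Finset.sum_le_sum_of_subset_of_nonneg (Finset.filter_subset _ _)
        fun x _ _ => mul_nonneg (hp0 x) (hΦ0 x)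
    _ = ∑ S ∈ Finset.univ.filter Finset.Nonempty, ∑ J ∈ Sᶜ.powerset,
          ∑ w : J → Λ, ∑ x, p x * (|partialBias g q S J w x| / θ S J) := by
        simp only [hΦ, Finset.mul_sum]
        rw [Finset.sum_comm]
        refine Finset.sum_congr rfl fun S _ => ?_
        rw [Finset.sum_comm]
        refine Finset.sum_congr rfl fun J _ => ?_
        rw [Finset.sum_comm]
    _ ≤ ∑ S ∈ Finset.univ.filter Finset.Nonempty, ∑ J ∈ Sᶜ.powerset,
          ∑ w : J → Λ, (T * DX * DY * M) ^ S.card / (n * N) ^ J.card := by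
        refine Finset.sum_le_sum fun S _ => Finset.sum_le_sum fun J hJ =>
          Finset.sum_le_sum fun w _ => hterm S J ?_ w
        rw [Finset.disjoint_right]
        exact fun i hi => Finset.mem_compl.1 (Finset.mem_powerset.1 hJ hi)
    -- The `N ^ |J|` choices of `w` cancel against the threshold, leaving `n ^ (-|J|)` to make the
    -- sum over `J` at most `e`.
    _ = ∑ S ∈ Finset.univ.filter Finset.Nonempty, (T * DX * DY * M) ^ S.card *
          ∑ J ∈ Sᶜ.powerset, (1 / (n : ℝ)) ^ J.card := by
        refine Finset.sum_congr rfl fun S _ => ?_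
        rw [Finset.mul_sum]
        refine Finset.sum_congr rfl fun J _ => ?_
        rw [Finset.sum_const, Finset.card_univ, Fintype.card_fun, Fintype.card_coe, nsmul_eq_mul,
          mul_pow (n : ℝ), one_div, inv_pow]
        push_cast
        rw [← hN]
        have : N ^ J.card ≠ 0 := by positivity
        field_simp
    _ ≤ ∑ S ∈ Finset.univ.filter Finset.Nonempty, (t * (1 / (n : ℝ)) ^ S.card) * 3 := by
        refine Finset.sum_le_sum fun S hS => mul_le_mul ?_ (hsum _)
          (Finset.sum_nonneg fun J _ => by positivity) (by positivity)
        have h1 : T * DX * DY * M ≤ t * (1 / n) := by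
          rw [mul_one_div, le_div_iff₀ hn0]; linarith
        calc (T * DX * DY * M) ^ S.card ≤ (t * (1 / n)) ^ S.card := by gcongr
          _ = t ^ S.card * (1 / (n : ℝ)) ^ S.card := mul_pow _ _ _
          -- A single factor `t` survives because `S` is nonempty.
          _ ≤ t * (1 / (n : ℝ)) ^ S.card := by
              gcongr
              exact pow_le_of_le_one ht0 ht
                (Finset.card_ne_zero.2 (Finset.mem_filter.1 hS).2)
    _ ≤ ∑ S ∈ (Finset.univ : Finset ι).powerset, (t * (1 / (n : ℝ)) ^ S.card) * 3 :=
        Finset.sum_le_sum_of_subset_of_nonneg (fun S _ => by simp) fun S _ _ => by positivity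
    _ ≤ 9 * t := by
        rw [← Finset.sum_mul, ← Finset.mul_sum]
        nlinarith [hsum Finset.univ]

/-- Interpolation: both `v = R ^ |J| / M ^ |S|` and the trivial factor `1` are available, and `min 1
v ≤ v ^ a` for `0 ≤ a ≤ 1`. -/
theorem HasSmallBiases.abs_le_of_disjoint {g : Λ → Λ → Bool} {q : (ι → Λ) → ℝ} {D R M a k u : ℝ}
    {x : ι → Λ} (h : HasSmallBiases g q D R M x) (hq0 : ∀ y, 0 ≤ q y) (hD : 0 ≤ D)
    (hq : MarginalBound q D) (hR : 0 < R) (hM : 0 < M) (ha0 : 0 ≤ a) (ha1 : a ≤ 1) (hk : 0 < k)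
    (hMk : k ≤ M ^ a) (hRu : R ^ a ≤ u) (hu : 1 ≤ u) {S J : Finset ι} (hSJ : Disjoint S J)
    (w : J → Λ) : |partialBias g q S J w x| ≤ D ^ J.card * (u ^ J.card * (1 / k) ^ S.card) := by
  have h1 := abs_partialBias_le g hq0 hD hq S J w x
  rcases S.eq_empty_or_nonempty with rfl | hS
  · refine h1.trans (le_mul_of_one_le_right (by positivity) ?_)
    simpa using one_le_pow₀ hu
  have h2 := h S J hS hSJ w
  set v := R ^ J.card / M ^ S.card
  have hv : 0 < v := by positivity
  have hva : v ^ a ≤ u ^ J.card * (1 / k) ^ S.card := by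
    rw [Real.div_rpow (by positivity) (by positivity), ← Real.rpow_natCast, ← Real.rpow_mul hR.le,
      mul_comm _ a, Real.rpow_mul hR.le, Real.rpow_natCast, ← Real.rpow_natCast M,
      ← Real.rpow_mul hM.le, mul_comm _ a, Real.rpow_mul hM.le, Real.rpow_natCast, one_div,
      inv_pow, ← div_eq_mul_inv]
    gcongr
  refine le_trans ?_ (mul_le_mul_of_nonneg_left hva (by positivity))
  rcases le_total v 1 with hv1 | hv1
  · refine h2.trans (mul_le_mul_of_nonneg_left ?_ (by positivity))
    simpa using Real.rpow_le_rpow_of_exponent_ge hv hv1 ha1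
  · exact h1.trans (le_mul_of_one_le_right (by positivity) (Real.one_le_rpow hv1 ha0))

theorem sum_powerset_le_three_halves {ι : Type*} [Fintype ι] {n : ℕ} (hn : 0 < n)
    (hcard : Fintype.card ι ≤ n) (I : Finset ι) : ∑ S ∈ I.powerset, (1 / (4 * n : ℝ)) ^ S.card ≤ 3 / 2 := by
  rw [sum_powerset_pow_card, ← div_div]
  refine (one_add_div_pow_le (by norm_num) ((Finset.card_le_univ I).trans hcard) hn).trans ?_
  -- The bound used is `exp (1/4) ≤ 1 / (1 - 1/4) = 4/3`.
  refine (Real.exp_bound_div_one_sub_of_interval (by norm_num) (by norm_num)).trans ?_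
  norm_num

theorem HasSmallBiases.two_pow_mul_sum_le {g : Λ → Λ → Bool} {q : (ι → Λ) → ℝ} {D R M a u : ℝ}
    {x : ι → Λ} (h : HasSmallBiases g q D R M x) (hq0 : ∀ y, 0 ≤ q y) (hD : 0 ≤ D)
    (hq : MarginalBound q D) (hR : 0 < R) (hM : 0 < M) (ha0 : 0 ≤ a) (ha1 : a ≤ 1) {n : ℕ}
    (hn : 0 < n) (hcard : Fintype.card ι ≤ n) (hMk : 4 * n ≤ M ^ a) (hRu : R ^ a ≤ u) (hu : 1 ≤ u)
    {I J : Finset ι} (hIJ : Disjoint I J) (z : ι → Bool) (w : J → Λ) :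
    2 ^ I.card * ∑ y with J.restrict y = w ∧ ∀ i ∈ I, g (x i) (y i) = z i, q y ≤
      D ^ J.card * (u ^ J.card * (3 / 2)) := by
  have hn0 : (0 : ℝ) < n := by exact_mod_cast hn
  rw [two_pow_mul_sum_eq]
  calc _ ≤ ∑ S ∈ I.powerset, D ^ J.card * (u ^ J.card * (1 / (4 * n : ℝ)) ^ S.card) := by
        refine Finset.sum_le_sum fun S hS => (le_abs_self _).trans ?_
        rw [abs_mul, Finset.abs_prod]
        simp only [abs_boolSign, Finset.prod_const_one, one_mul]
        exact h.abs_le_of_disjoint hq0 hD hq hR hM ha0 ha1 (by positivity) hMk hRu hu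
          (hIJ.mono_left (Finset.mem_powerset.1 hS)) w
    _ ≤ _ := by
        rw [← Finset.mul_sum, ← Finset.mul_sum]
        gcongr
        exact sum_powerset_le_three_halves hn hcard I

/-- The empty parity contributes exactly `1`, and the others total at most `3/2 - 1` in absolute
value. -/
theorem HasSmallBiases.half_le_two_pow_mul_sum {g : Λ → Λ → Bool} {q : (ι → Λ) → ℝ}
    {D R M a : ℝ} {x : ι → Λ} (h : HasSmallBiases g q D R M x)
    (hq1 : ∑ y, q y = 1) (hM : 1 ≤ M) (ha1 : a ≤ 1) {n : ℕ}
    (hn : 0 < n) (hcard : Fintype.card ι ≤ n) (hMk : 4 * n ≤ M ^ a) (I : Finset ι)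
    (z : ι → Bool) :
    1 / 2 ≤ 2 ^ I.card * ∑ y with ∀ i ∈ I, g (x i) (y i) = z i, q y := by
  have hn0 : (0 : ℝ) < n := by exact_mod_cast hn
  have hMk' : 4 * (n : ℝ) ≤ M :=
    hMk.trans ((Real.rpow_le_rpow_of_exponent_le hM ha1).trans (Real.rpow_one M).le)
  have hemp : ∀ (w : (∅ : Finset ι) → Λ) (y : ι → Λ), (∅ : Finset ι).restrict y = w := fun w y =>
    funext fun i => absurd i.2 (Finset.notMem_empty _)
  have h1 : 2 ^ I.card * ∑ y with ∀ i ∈ I, g (x i) (y i) = z i, q y = ∑ S ∈ I.powerset,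
      (∏ i ∈ S, boolSign (z i)) *
        partialBias g q S ∅ (fun i => absurd i.2 (Finset.notMem_empty _)) x := by
    rw [← two_pow_mul_sum_eq]
    congr 1
    exact Finset.sum_congr (Finset.filter_congr fun y _ => (and_iff_right (hemp _ y)).symm)
      fun _ _ => rfl
  rw [h1, ← Finset.add_sum_erase _ _ (Finset.empty_mem_powerset I)]
  have h0 : partialBias g q ∅ ∅ (fun i => absurd i.2 (Finset.notMem_empty _)) x = 1 := by
    rw [partialBias, Finset.filter_true_of_mem fun y _ => hemp _ y]
    simp [hq1]
  rw [h0, Finset.prod_empty, one_mul]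
  have h2 := sum_powerset_le_three_halves hn hcard I
  rw [← Finset.add_sum_erase _ _ (Finset.empty_mem_powerset I)] at h2
  simp only [Finset.card_empty, pow_zero] at h2
  have h3 : |∑ S ∈ I.powerset.erase ∅, (∏ i ∈ S, boolSign (z i)) *
      partialBias g q S ∅ (fun i => absurd i.2 (Finset.notMem_empty _)) x|
      ≤ ∑ S ∈ I.powerset.erase ∅, (1 / (4 * n : ℝ)) ^ S.card := by
    refine (Finset.abs_sum_le_sum_abs _ _).trans (Finset.sum_le_sum fun S hS => ?_)
    rw [abs_mul, Finset.abs_prod]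
    simp only [abs_boolSign, Finset.prod_const_one, one_mul]
    have hS' := Finset.nonempty_iff_ne_empty.2 (Finset.mem_erase.1 hS).1
    refine (h S ∅ hS' (Finset.disjoint_empty_right S) _).trans ?_
    simp only [Finset.card_empty, pow_zero, one_mul, one_div, inv_pow]
    gcongr
  have h4 := (abs_le.1 h3).1
  linarith

end Bias

/-! ### Laws of random variables with finitely many values -/

section Law

variable {Ω : Type*} [MeasurableSpace Ω]

theorem measureReal_eq_sum {β : Type*} [Fintype β] [MeasurableSpace β]
    [MeasurableSingletonClass β] (P : Measure Ω) [IsFiniteMeasure P] {Y : Ω → β}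
    (hY : Measurable Y) (r : β → Prop) [DecidablePred r] :
    P.real {ω | r (Y ω)} = ∑ y with r y, P.real (Y ⁻¹' {y}) := by
  have h := sum_measureReal_preimage_singleton (μ := P) (Finset.univ.filter r)
    (f := Y) fun y _ => hY (measurableSet_singleton y)
  rw [h]
  congr 1
  ext ω
  simp

theorem measureReal_le_of_le_minEntropy {α : Type*} [Finite α] {P : Measure Ω}
    [IsProbabilityMeasure P] {X : Ω → α} {k : ℝ} (h : k ≤ minEntropy P X) (x : α) :
    P.real (X ⁻¹' {x}) ≤ (2 : ℝ) ^ (-k) :=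
  ((isGreatest_minEntropy P X).1 x).trans
    (Real.rpow_le_rpow_of_exponent_le one_le_two (neg_le_neg h))

theorem exists_lt_measureReal_of_minEntropy_lt {α : Type*} [Finite α] {P : Measure Ω}
    [IsProbabilityMeasure P] {X : Ω → α} {k : ℝ} (h : minEntropy P X < k) :
    ∃ x, (2 : ℝ) ^ (-k) < P.real (X ⁻¹' {x}) := by
  by_contra! hk
  exact absurd ((isGreatest_minEntropy P X).2 hk) (not_le.2 h)

variable {ι : Type*} [Fintype ι] [DecidableEq ι] {b : ℕ}

theorem IsDense.marginalBound {P : Measure Ω} [IsProbabilityMeasure P] {δ : ℝ}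
    {W : Ω → ι → Block b} (h : IsDense P δ W) (hW : Measurable W) :
    MarginalBound (fun y => P.real (W ⁻¹' {y})) ((2 : ℝ) ^ (-(δ * b))) := by
  intro I w
  rw [← measureReal_eq_sum P hW]
  have h1 := measureReal_le_of_le_minEntropy (h I) (I.restrict w)
  have h2 : (fun ω => I.restrict (W ω)) ⁻¹' {I.restrict w} = {ω | ∀ i ∈ I, W ω i = w i} := by
    ext ω
    simp only [Set.mem_preimage, Set.mem_singleton_iff, restrict_eq_restrict_iff]
    rfl
  rw [h2] at h1
  refine h1.trans (le_of_eq ?_)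
  rw [← Real.rpow_natCast, ← Real.rpow_mul zero_le_two, neg_mul]

theorem gadgetEvent_eq {Ω ι : Type*} {b : ℕ} (g : Block b → Block b → Bool) (W : Ω → ι → Block b)
    (x : ι → Block b) {I : Finset ι} {z : I → Bool} {z' : ι → Bool} (hz : I.restrict z' = z) :
    gadgetEvent g W x I z = {ω | ∀ i ∈ I, g (x i) (W ω i) = z' i} := by
  ext ω
  subst hz
  simp [gadgetEvent, gPow, funext_iff]

theorem exists_restrict_eq {ι : Type*} [DecidableEq ι] (I : Finset ι) (z : I → Bool) :
    ∃ z' : ι → Bool, I.restrict z' = z :=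
  ⟨fun i => if h : i ∈ I then z ⟨i, h⟩ else false, by ext i; simp⟩

theorem measurableSet_gadgetEvent {ι : Type*} [Finite ι] {b : ℕ}
    (g : Block b → Block b → Bool) {W : Ω → ι → Block b}
    (hW : Measurable W) (x : ι → Block b) (I : Finset ι) (z : I → Bool) :
    MeasurableSet (gadgetEvent g W x I z) :=
  hW (Set.toFinite {y : ι → Block b | gPow g (I.restrict x) (I.restrict y) = z}).measurableSet

/-- A value with small biases is not dangerous. -/
theorem HasSmallBiases.not_isDangerous {P : Measure Ω} [IsProbabilityMeasure P]
    {g : Block b → Block b → Bool} {δ ε R M a u : ℝ} {W : Ω → ι → Block b} {x : ι → Block b}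
    (h : HasSmallBiases g (fun y => P.real (W ⁻¹' {y})) ((2 : ℝ) ^ (-(δ * b))) R M x)
    (hW : Measurable W) (hδ : IsDense P δ W) (hR : 0 < R) (hM : 1 ≤ M) (ha0 : 0 ≤ a) (ha1 : a ≤ 1)
    {n : ℕ} (hn : 0 < n) (hcard : Fintype.card ι ≤ n) (hMk : 4 * n ≤ M ^ a) (hRu : R ^ a ≤ u)
    (hu : 3 ≤ u) (hε : u ^ 2 = (2 : ℝ) ^ (ε * b)) : ¬ IsDangerous P g δ ε W x := by
  set q : (ι → Block b) → ℝ := fun y => P.real (W ⁻¹' {y}) with hq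
  have hq1 : ∑ y, q y = 1 := by
    have := measureReal_eq_sum P hW fun _ => True
    simpa using this.symm
  have hq0 : ∀ y, 0 ≤ q y := fun y => measureReal_nonneg
  have hleak : ∀ (I : Finset ι) (z : I → Bool),
      (2 : ℝ) ^ (-(I.card : ℝ) - 1) ≤ P.real (gadgetEvent g W x I z) := by
    intro I z
    obtain ⟨z', hz⟩ := exists_restrict_eq I z
    rw [gadgetEvent_eq g W x hz,
      measureReal_eq_sum P hW fun y => ∀ i ∈ I, g (x i) (y i) = z' i]
    have h1 := h.half_le_two_pow_mul_sum hq1 hM ha1 hn hcard hMk I z'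
    rw [Real.rpow_sub two_pos, Real.rpow_neg zero_le_two, Real.rpow_natCast, Real.rpow_one,
      div_le_iff₀ two_pos, inv_le_iff_one_le_mul₀ (by positivity)]
    linarith
  rintro (⟨I, z, hlt⟩ | ⟨I, z, hnd⟩)
  · exact absurd hlt (not_lt.2 (hleak I z))
  set E := gadgetEvent g W x I z with hE
  have hEm : MeasurableSet E := measurableSet_gadgetEvent g hW x I z
  have hE0 : 0 < P.real E := lt_of_lt_of_le (by positivity) (hleak I z)
  have : IsProbabilityMeasure (P[|E]) :=
    cond_isProbabilityMeasure fun h0 => hE0.ne' (by simp [measureReal_def, h0])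
  simp only [IsDense, not_forall, not_le] at hnd
  obtain ⟨J, hJ⟩ := hnd
  obtain ⟨v, hv⟩ := exists_lt_measureReal_of_minEntropy_lt hJ
  rw [measureReal_def, cond_apply hEm, ENNReal.toReal_mul, ENNReal.toReal_inv, ← measureReal_def,
    ← measureReal_def, inv_mul_eq_div, lt_div_iff₀ hE0] at hv
  set F := (fun ω => J.restrict ((Iᶜ : Finset ι).restrict (W ω))) ⁻¹' {v} with hF
  have hEF : (E ∩ F).Nonempty := by
    by_contra hne
    rw [Set.not_nonempty_iff_eq_empty] at hne
    rw [hne, measureReal_empty] at hv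
    exact absurd hv (not_lt.2 (by positivity))
  obtain ⟨ω₀, -, hω₀⟩ := hEF
  -- The ratio of the bounds `3/2` and `1/2` leaves a factor `3`, absorbed by `u ^ |J|` only for
  -- nonempty `J`.
  have hJ0 : J.card ≠ 0 := by
    intro h0
    rw [h0, Nat.cast_zero, mul_zero, neg_zero, Real.rpow_zero, one_mul] at hv
    exact absurd hv (not_lt.2 (measureReal_mono Set.inter_subset_left))
  set K : Finset ι := J.map (Function.Embedding.subtype _) with hK
  have hKc : K.card = J.card := Finset.card_map _
  have hIK : Disjoint I K := by
    rw [Finset.disjoint_right]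
    intro i hi
    rw [hK, Finset.mem_map] at hi
    obtain ⟨j, -, rfl⟩ := hi
    exact Finset.mem_compl.1 j.2
  obtain ⟨z', hz⟩ := exists_restrict_eq I z
  have hEFeq : E ∩ F = {ω | K.restrict (W ω) = K.restrict (W ω₀) ∧
      ∀ i ∈ I, g (x i) (W ω i) = z' i} := by
    have hv' : v = J.restrict ((Iᶜ : Finset ι).restrict (W ω₀)) := hω₀.symm
    ext ω
    rw [hE, gadgetEvent_eq g W x hz, hF, hv', Set.mem_inter_iff, and_comm]
    refine and_congr ?_ Iff.rfl
    simp only [Set.mem_preimage, Set.mem_singleton_iff, restrict_eq_restrict_iff]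
    simp [hK]
  have h1 := h.two_pow_mul_sum_le hq0 (by positivity) (hδ.marginalBound hW) hR
    (zero_lt_one.trans_le hM) ha0 ha1 hn hcard hMk hRu (by linarith) hIK z' (K.restrict (W ω₀))
  rw [← measureReal_eq_sum P hW fun y => K.restrict y = K.restrict (W ω₀) ∧
      ∀ i ∈ I, g (x i) (y i) = z' i, ← hEFeq, hKc] at h1
  -- The allowance `2 ^ (ε b)` per coordinate is spent as `u * u`: one factor for the interpolated
  -- bias bound, one for the constant `3`.
  have h2 : (2 : ℝ) ^ (-((δ - ε) * b * J.card))
      = ((2 : ℝ) ^ (-(δ * b))) ^ J.card * (u ^ J.card * u ^ J.card) := by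
    rw [← mul_pow u, ← pow_two, hε, ← mul_pow, ← Real.rpow_add two_pos, ← Real.rpow_natCast,
      ← Real.rpow_mul zero_le_two]
    congr 1
    ring
  have h3 := hleak I z
  rw [Real.rpow_sub two_pos, Real.rpow_neg zero_le_two, Real.rpow_natCast, Real.rpow_one] at h3
  have h4 : 3 ≤ u ^ J.card := by
    calc (3 : ℝ) ≤ u := hu
      _ ≤ u ^ J.card := le_self_pow₀ (by linarith) hJ0
  set d := ((2 : ℝ) ^ (-(δ * b))) ^ J.card
  have hd : 0 < d := by positivity
  set m := u ^ J.card
  have h5 : (2 : ℝ) ^ I.card * P.real (E ∩ F) ≤ 2 ^ I.card *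
      ((2 : ℝ) ^ (-((δ - ε) * b * J.card)) * (((2 : ℝ) ^ I.card)⁻¹ / 2)) := by
    rw [h2]
    calc _ ≤ d * (m * (3 / 2)) := h1
      _ ≤ d * (m * (m / 2)) := by gcongr
      _ = _ := by field_simp
  have h6 := le_of_mul_le_mul_left h5 (by positivity)
  exact absurd (h6.trans (mul_le_mul_of_nonneg_left h3 (by positivity))) (not_le.2 hv)

theorem measureReal_isDangerous_le {P : Measure Ω} [IsProbabilityMeasure P]
    {η δX δY γ ε : ℝ} {c n : ℕ} {g : Block b → Block b → Bool} {X Y : Ω → ι → Block b}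
    (hX : Measurable X) (hY : Measurable Y) (hcard : Fintype.card ι ≤ n) (hc : 1 ≤ c) (hn : 2 ≤ n)
    (hcb : (c : ℝ) * Real.logb 2 n ≤ b) (hg : disc g ≤ (2 : ℝ) ^ (-(η * b))) (hγ : 0 < γ)
    (hε0 : 0 < ε) (hε1 : ε ≤ 1) (hεb : 4 / (b : ℝ) ≤ ε)
    (hτ : 2 + 21 / (c * ε) - η + γ ≤ δX + δY) (hδX : IsDense P δX X) (hδY : IsDense P δY Y) :
    P.real {ω | IsDangerous P g δY ε Y (X ω)} ≤ (2 : ℝ) ^ (-(γ * b)) := by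
  classical
  have hc0 : (0 : ℝ) < c := by exact_mod_cast hc
  have hc1 : (1 : ℝ) ≤ c := by exact_mod_cast hc
  have hn0 : (0 : ℝ) < n := by positivity
  have hn2 : (2 : ℝ) ≤ n := by exact_mod_cast hn
  have hlog : 1 ≤ Real.logb 2 n := by
    rw [Real.le_logb_iff_rpow_le one_lt_two hn0, Real.rpow_one]; exact hn2
  have hlb : Real.logb 2 n ≤ b / c := by rw [le_div_iff₀ hc0]; linarith
  have hb0 : (0 : ℝ) < b := by nlinarith
  set B : ℝ := b / (c * ε) with hB
  have hbB : b / c ≤ B := by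
    rw [hB, ← div_div]
    exact le_div_self (by positivity) hε0 hε1
  have hB1 : 1 ≤ B := hlog.trans (hlb.trans hbB)
  have hnbc : (n : ℝ) ≤ 2 ^ (b / c : ℝ) :=
    (Real.logb_le_iff_le_rpow one_lt_two hn0).1 hlb
  have hnb : (n : ℝ) ≤ 2 ^ (b : ℝ) := hnbc.trans
    (Real.rpow_le_rpow_of_exponent_le one_le_two (div_le_self hb0.le hc1))
  have hnB : (n : ℝ) ≤ 2 ^ B := hnbc.trans (Real.rpow_le_rpow_of_exponent_le one_le_two hbB)
  have hN : (Fintype.card (Block b) : ℝ) = 2 ^ (b : ℝ) := by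
    simp [Block]
  have hεb' : 4 ≤ ε * b := (div_le_iff₀ hb0).1 hεb
  -- Chosen so that `M ^ (ε / 4) = 2 ^ (3 b / c) ≥ n ^ 3 ≥ 4 n`.
  set M : ℝ := 2 ^ (12 * B) with hM
  have hM1 : 1 ≤ M := Real.one_le_rpow one_le_two (by linarith)
  set u : ℝ := 2 ^ (ε * b / 2) with hu
  have hu3 : 3 ≤ u := by
    calc (3 : ℝ) ≤ 2 ^ (2 : ℝ) := by norm_num
      _ ≤ u := Real.rpow_le_rpow_of_exponent_le one_le_two (by linarith)
  have hMk : 4 * (n : ℝ) ≤ M ^ (ε / 4) := by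
    have h1 : M ^ (ε / 4) = (2 ^ (b / c : ℝ)) ^ (3 : ℕ) := by
      rw [hM, ← Real.rpow_mul zero_le_two, ← Real.rpow_natCast, ← Real.rpow_mul zero_le_two, hB]
      congr 1
      push_cast
      field_simp
      ring
    rw [h1]
    calc 4 * (n : ℝ) ≤ n ^ 3 := by nlinarith [mul_self_nonneg ((n : ℝ) - 2)]
      _ ≤ _ := by gcongr
  have hRu : ((n : ℝ) * Fintype.card (Block b)) ^ (ε / 4) ≤ u := by
    rw [hN]
    calc _ ≤ ((2 : ℝ) ^ (b : ℝ) * 2 ^ (b : ℝ)) ^ (ε / 4) := by gcongr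
      _ = u := by
        rw [← Real.rpow_add two_pos, ← Real.rpow_mul zero_le_two, hu]
        congr 1
        ring
  have hu2 : u ^ 2 = (2 : ℝ) ^ (ε * b) := by
    rw [hu, ← Real.rpow_natCast, ← Real.rpow_mul zero_le_two]
    congr 1
    push_cast
    ring
  -- The overhead `216 * n * M`, with `216 = 24 * 9`, is at most `2 ^ ((8 + 1 + 12) B)`. This is the
  -- origin of the constant `21`.
  have hbound : n * (6 * (4 * ((Fintype.card (Block b) : ℝ) ^ 2 * disc g)) * 2 ^ (-(δX * b)) *
      2 ^ (-(δY * b)) * M) ≤ (2 : ℝ) ^ (-(γ * b)) / 9 := by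
    rw [le_div_iff₀ (by norm_num), hN]
    calc _ = 216 * n * (((2 : ℝ) ^ (b : ℝ)) ^ 2 * disc g * 2 ^ (-(δX * b)) * 2 ^ (-(δY * b)) * M) := by
          ring
      _ ≤ 2 ^ (8 * B) * 2 ^ B * (((2 : ℝ) ^ (b : ℝ)) ^ 2 * 2 ^ (-(η * b)) * 2 ^ (-(δX * b)) *
            2 ^ (-(δY * b)) * M) := by
          have h216 : (216 : ℝ) ≤ 2 ^ (8 * B) := by
            calc (216 : ℝ) ≤ 2 ^ (8 : ℝ) := by norm_num
              _ ≤ _ := Real.rpow_le_rpow_of_exponent_le one_le_two (by linarith)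
          have : 0 ≤ disc g := (abs_nonneg _).trans ((isGreatest_disc g).2 ⟨(∅, ∅), rfl⟩)
          gcongr
      _ = 2 ^ (21 * B + 2 * b - η * b - δX * b - δY * b) := by
          rw [hM, ← Real.rpow_natCast, ← Real.rpow_mul zero_le_two]
          simp only [← Real.rpow_add two_pos]
          congr 1
          push_cast
          ring
      _ ≤ (2 : ℝ) ^ (-(γ * b)) := by
          refine Real.rpow_le_rpow_of_exponent_le one_le_two ?_
          have h1 := mul_le_mul_of_nonneg_right hτ hb0.le
          have h2 : 21 * B = 21 / (c * ε) * b := by rw [hB]; ring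
          rw [h2]
          linarith
  have ht1 : (2 : ℝ) ^ (-(γ * b)) / 9 ≤ 1 := by
    have : (2 : ℝ) ^ (-(γ * b)) ≤ 1 :=
      Real.rpow_le_one_of_one_le_of_nonpos one_le_two (by nlinarith)
    linarith
  have hmain := sum_not_hasSmallBiases_le g (p := fun x => P.real (X ⁻¹' {x}))
    (q := fun y => P.real (Y ⁻¹' {y})) (by omega : 0 < n) hcard (fun _ => measureReal_nonneg)
    (fun _ => measureReal_nonneg) (Real.rpow_pos_of_pos two_pos _)
    (Real.rpow_pos_of_pos two_pos _) (zero_lt_one.trans_le hM1) (hδX.marginalBound hX)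
    (hδY.marginalBound hY) ht1 hbound
  rw [← measureReal_eq_sum P hX] at hmain
  refine (measureReal_mono fun ω hω => ?_).trans (hmain.trans (by linarith))
  intro hsmall
  have hcard0 : 0 < (Fintype.card (Block b) : ℝ) := by rw [hN]; positivity
  exact hsmall.not_isDangerous hY hδY (by positivity) hM1 (by linarith)
    (by linarith) (by omega) hcard hMk hRu hu3 hu2 hω

/-- Raising `δ` strengthens the density demanded after conditioning, so sparsifying values stay
sparsifying. -/
theorem IsDangerous.mono {P : Measure Ω} [IsProbabilityMeasure P] {g : Block b → Block b → Bool}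
    {δ δ' ε : ℝ} {W : Ω → ι → Block b} {x : ι → Block b} (h : IsDangerous P g δ ε W x)
    (hδ : δ ≤ δ') : IsDangerous P g δ' ε W x := by
  refine h.imp_right fun ⟨I, z, hI⟩ => ⟨I, z, fun h' => hI fun J => le_trans ?_ (h' J)⟩
  gcongr

end Law

end Lifting

theorem mainTheorem4 :
    ∃ h : ℝ, 0 < h ∧
      ∀ (η : ℝ) (c n b : ℕ) (g : Lifting.Block b → Lifting.Block b → Bool),
        0 < η → 1 ≤ c → 2 ≤ n →
        (c : ℝ) * Real.logb 2 (n : ℝ) ≤ (b : ℝ) →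
        Lifting.disc g ≤ (2 : ℝ) ^ (-(η * (b : ℝ))) →
        ∀ (γ ε τ : ℝ), 0 < γ → γ ≤ 1 → 0 < ε → ε ≤ 1 → 0 < τ →
          2 + h / ((c : ℝ) * ε) - η + γ ≤ τ →
          4 / (b : ℝ) ≤ ε →
          ∀ (ρ : Fin n → Option Bool)
            (Ω : Type*) [MeasurableSpace Ω] (P : Measure Ω) [IsProbabilityMeasure P]
            (X Y : Ω → Fin n → Lifting.Block b),
            Measurable X → Measurable Y →
            Lifting.IsStructured P g ρ τ X Y →
            ∀ δY : ℝ, 0 < δY →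
              Lifting.IsDense P δY (fun ω => (Lifting.free ρ).restrict (Y ω)) →
              P.real {ω | Lifting.IsDangerous P g δY ε
                  (fun ω' => (Lifting.free ρ).restrict (Y ω'))
                  ((Lifting.free ρ).restrict (X ω))}
                ≤ (2 : ℝ) ^ (-(γ * (b : ℝ))) := by
  refine ⟨21, by norm_num, ?_⟩
  intro η c n b g _ hc hn hcb hg γ ε τ hγ _ hε0 hε1 _ hτ hεb ρ Ω _ P _ X Y hX hY hXY δY hδY0 hY'
  obtain ⟨-, ⟨δX, δY', -, -, hdX, hdY', hsum⟩, -⟩ := hXY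
  have hmX : Measurable fun ω => (Lifting.free ρ).restrict (X ω) :=
    (Finset.measurable_restrict _).comp hX
  have hmY : Measurable fun ω => (Lifting.free ρ).restrict (Y ω) :=
    (Finset.measurable_restrict _).comp hY
  have hcard : Fintype.card (Lifting.free ρ) ≤ n := by
    rw [Fintype.card_coe]
    exact (Finset.card_le_univ _).trans (Fintype.card_fin n).le
  -- The given `δY` may be smaller than the rate `δY'` for which `δX + δY' ≥ τ`. The maximum of the
  -- two satisfies that inequality and makes no fewer values dangerous.
  have hmax : Lifting.IsDense P (max δY δY') fun ω => (Lifting.free ρ).restrict (Y ω) := by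
    rcases max_choice δY δY' with h | h <;> rw [h] <;> assumption
  refine le_trans (measureReal_mono fun ω hω => ?_)
    (Lifting.measureReal_isDangerous_le hmX hmY hcard hc hn hcb hg hγ hε0 hε1 hεb
      (hτ.trans (hsum.trans (add_le_add_right (le_max_right δY δY') δX))) hdX hmax)
  exact Lifting.IsDangerous.mono hω (le_max_left _ _)
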